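/- Let $n\ge 2$, $p>1$, and $p<\frac{n+2}{n-2}$ if $n>2$. All functions are real-valued on $\mathbb R^n$, and $\vec R:=\nabla(-\Delta)^{-1/2}$ denotes the Fourier multiplier with symbol $i\xi/|\xi|$. For $\vec c\in\mathbb R^n$ let $L_{\vec c}^{1/2}=\vec c\cdot\vec R$, so that $L_{\vec c}=(\vec c\cdot\nabla)^2(-\Delta)^{-1}$. For $u\in H^1(\mathbb R^n)$ and $v\in L^2(\mathbb R^n)$ put $$J(u;\vec c)=\tfrac12\int\big(|\nabla u|^2+|u|^2-|L_{\vec c}^{1/2}u|^2\big)dx,\qquad K(u)=\tfrac1{p+1}\|u\|_{L^{p+1}}^{p+1},\qquad N(u;\vec c)=J(u;\vec c)-K(u),$$ $$E(u,v)=\tfrac12\int\big(|v|^2+|u|^2+|\nabla u|^2\big)dx-K(u),\qquad F(u,v)=\int v\,\vec R u\,dx\in\mathbb R^n,\qquad S_{\vec c}=E+\vec c\cdot F,$$ and $m(\vec c)=\inf\{J(u;\vec c): u\in H^1,\ K(u)=1\}$. Define * $G(\vec c)$, the set of $u\in H^1$ with $(p+1)K(u)=2J(u;\vec c)=2\left(\frac2{p+1}\right)^{\frac2{p-1}}m(\vec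 c)^{\frac{p+1}{p-1}}$ (the ground states), and $\mathcal G(\vec c)=\{(\phi,-L_{\vec c}^{1/2}\phi):\phi\in G(\vec c)\}$; * $G_1(\vec c)$, the set of nonzero critical points of $N(\cdot\,;\vec c)$ on $H^1$ at which $N(\cdot\,;\vec c)$ is least among all its nonzero critical points. For $|\vec c|<1$ let $d(\vec c)=S_{\vec c}(\vec\phi)$ with $\vec\phi\in\mathcal G(\vec c)$; this is well defined: $\mathcal G(\vec c)\neq\emptyset$, and the value does not depend on the choice of $\vec\phi$. Let $\vec s\in\mathbb R^n$ with $0<|\vec s|\le1$, and let $d_{\vec s}(\zeta)=d(\zeta\vec s)$ for $\zeta\in[0,1)$. Then $d_{\vec s}$ is continuous and strictly decreasing on $[0,1)$, and it is differentiable at almost every $\zeta\in[0,1)$. At every $\zeta\in[0,1)$ at which $d_{\vec s}$ is differentiable (from the right if $\zeta=0$), $$d_{\vec s}'(\zeta)=-\zeta\,\|L_{\vec s}^{1/2}\phi\|_{L^2}^2\qquad\text{for every }\phi\in G_1(\zeta\vec s),$$ and moreover $d$ is differentiable at the point $\vec c=\zeta\vec s$ of the unit ball, with $$\nabla_{\vec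 c}\,d(\vec c)=F(\vec\phi)\qquad\text{for every }\vec\phi\in\mathcal G(\vec c).$$ -/

import Mathlib

open MeasureTheory
open scoped FourierTransform ENNReal

namespace Boussinesq

noncomputable section

/-- `ℝⁿ` with its Euclidean norm. -/
abbrev Rn (n : ℕ) := EuclideanSpace ℝ (Fin n)

/-- Real-valued `L²(ℝⁿ)`. -/
abbrev L2 (n : ℕ) := Lp ℝ 2 (volume : Measure (Rn n))

/-- Complex-valued `L²(ℝⁿ)`. -/
abbrev L2C (n : ℕ) := Lp ℂ 2 (volume : Measure (Rn n))

variable {n : ℕ}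

/-- A real-valued `L²` function seen as a complex-valued one. -/
def toComplex (u : L2 n) : L2C n := Complex.ofRealCLM.compLp u

/-- The `L²` Fourier transform of a real-valued function, in Mathlib's normalization
`û(ξ) = ∫ e^{-2πi x·ξ} u(x) dx`; in it `∂_j` has the symbol `2πi ξ_j`. -/
def hat (u : L2 n) : L2C n := 𝓕 (toComplex u)

/-- The Sobolev space `H¹(ℝⁿ)` of real-valued functions. -/
def MemH1 (u : L2 n) : Prop :=
  TemperedDistribution.MemSobolev 1 2 (Lp.toTemperedDistribution (toComplex u))

/-- `‖∇u‖²_{L²}`, written with Plancherel's theorem; finite exactly on `H¹`. -/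
def gradSq (u : L2 n) : ℝ :=
  ∫ ξ : Rn n, (2 * Real.pi * ‖ξ‖) ^ 2 * ‖hat u ξ‖ ^ 2

/-- The symbol `i (c·ξ)/|ξ|` of the operator `(c·∇)(-Δ)^{-1/2}`. -/
def halfSymbol (c ξ : Rn n) : ℂ := Complex.I * ((inner ℝ c ξ / ‖ξ‖ : ℝ) : ℂ)

theorem halfSymbol_memLp (c : Rn n) :
    MemLp (halfSymbol c) ∞ (volume : Measure (Rn n)) := by
  refine memLp_top_of_bound ?_ ‖c‖ (Filter.Eventually.of_forall fun ξ => ?_)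
  · have h : Measurable (halfSymbol c) := by
      unfold halfSymbol
      fun_prop
    exact h.aestronglyMeasurable
  · have h1 : ‖halfSymbol c ξ‖ = |inner ℝ c ξ| / ‖ξ‖ := by
      simp only [halfSymbol, norm_mul, Complex.norm_I, one_mul, Complex.norm_real,
        Real.norm_eq_abs, abs_div, abs_norm]
    rw [h1]
    exact div_le_of_le_mul₀ (norm_nonneg _) (norm_nonneg _) (abs_real_inner_le_norm c ξ)

/-- The operator `L_c^{1/2} = (c·∇)(-Δ)^{-1/2}` on complex-valued `L²`, a Fourier multiplier.
Its square `L_c = (c·∇)²(-Δ)^{-1}` has the symbol `-(c·ξ)²/|ξ|²`. -/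
def lhalfC (c : Rn n) (f : L2C n) : L2C n :=
  𝓕⁻ (((halfSymbol_memLp c).toLp (halfSymbol c) • 𝓕 f : L2C n))

/-- The operator `L_c^{1/2}` on real-valued `L²`. It maps real-valued functions to real-valued
functions (its symbol takes conjugate values at `ξ` and `-ξ`), so that the real part taken here
only changes the type. -/
def lhalf (c : Rn n) (u : L2 n) : L2 n := Complex.reCLM.compLp (lhalfC c (toComplex u))

/-- `K(u) = (p+1)⁻¹ ‖u‖_{L^{p+1}}^{p+1}`. -/
def K (p : ℝ) (u : L2 n) : ℝ := 1 / (p + 1) * ∫ x : Rn n, |u x| ^ (p + 1)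

/-- `J(u) = ½ ∫ (|∇u|² + |u|² - |L_c^{1/2} u|²)`. -/
def J (c : Rn n) (u : L2 n) : ℝ := 1 / 2 * (gradSq u + ‖u‖ ^ 2 - ‖lhalf c u‖ ^ 2)

/-- The scalar action `J - K`. -/
def scalarAction (p : ℝ) (c : Rn n) (u : L2 n) : ℝ := J c u - K p u

/-- The energy `½ ∫ (|v|² + |u|² + |∇u|²) - (p+1)⁻¹ ∫ |u|^{p+1}` of a pair `w = (u, v)`. -/
def energy (p : ℝ) (w : L2 n × L2 n) : ℝ :=
  1 / 2 * (‖w.2‖ ^ 2 + ‖w.1‖ ^ 2 + gradSq w.1) - K p w.1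

/-- The momentum `∫ v ∇((-Δ)^{-1/2} u)`, a vector of `ℝⁿ`, of a pair `w = (u, v)`; its `j`-th
component is the integral of `v` against `∂_j (-Δ)^{-1/2} u`. -/
def momentum (w : L2 n × L2 n) : Rn n :=
  WithLp.toLp 2 fun j => ∫ x : Rn n, w.2 x * lhalf (EuclideanSpace.single j (1 : ℝ)) w.1 x

/-- The action `S_c = E + c·F`. -/
def action (p : ℝ) (c : Rn n) (w : L2 n × L2 n) : ℝ :=
  energy p w + inner ℝ c (momentum w)

/-- `m(c) = inf {J(u) : u ∈ H¹, K(u) = 1}`. -/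
def mInf (p : ℝ) (c : Rn n) : ℝ := sInf (J c '' {u : L2 n | MemH1 u ∧ K p u = 1})

/-- The set `G(c)` of ground states. -/
def groundStates (p : ℝ) (c : Rn n) : Set (L2 n) :=
  {u | MemH1 u ∧ (p + 1) * K p u = 2 * J c u ∧
    2 * J c u = 2 * (2 / (p + 1)) ^ (2 / (p - 1)) * mInf p c ^ ((p + 1) / (p - 1))}

/-- The set of pairs `(φ, -L_c^{1/2} φ)`, where `φ ∈ G(c)`. -/
def groundPairs (p : ℝ) (c : Rn n) : Set (L2 n × L2 n) :=
  {w | w.1 ∈ groundStates p c ∧ w.2 = -lhalf c w.1}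

/-- `u` is a critical point on `H¹` of the scalar action `J - K`. -/
def IsCriticalPoint (p : ℝ) (c : Rn n) (u : L2 n) : Prop :=
  MemH1 u ∧ ∀ w : L2 n, MemH1 w → HasDerivAt (fun t : ℝ => scalarAction p c (u + t • w)) 0 0

/-- The set `G₁(c)` of nonzero critical points of `J - K` of least action. -/
def leastActionStates (p : ℝ) (c : Rn n) : Set (L2 n) :=
  {φ | φ ≠ 0 ∧ IsCriticalPoint p c φ ∧
    ∀ u : L2 n, u ≠ 0 → IsCriticalPoint p c u → scalarAction p c φ ≤ scalarAction p c u}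

/-- `d(c) = S_c(w)` for a pair `w = (φ, -L_c^{1/2} φ)` with `φ ∈ G(c)`. -/
def d (p : ℝ) (c : Rn n) : ℝ := action p c (Classical.epsilon fun w => w ∈ groundPairs p c)

end

end Boussinesq

namespace Boussinesq

noncomputable section

variable {n : ℕ}

open Filter Topology

/-! Everything rests on the identity `d c = κ * m(c) ^ α`, where `α = (p+1)/(p-1)`, `κ > 0` depends
only on `p`, and `m(c)` is `mInf p c` (`d_eq`). It holds because a minimizer for `m(c)`, suitably
rescaled, is a ground state, and because `S_c` on a ground pair equals `J - K`, which the relation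
between `K` and `J` turns into `(p-1)/(p+1)` times the ground level.

The analytic core is that `m(c)` is attained for `|c| < 1` (`exists_minimizer`). A minimizing
sequence cannot vanish, since its high frequencies are uniformly small in `L^{p+1}` and hence its
low frequencies are large at some point; translating that point to the origin gives a nonzero weak
limit. Nor can it split: `J` decouples along weak limits, `K` does so by Brezis–Lieb, and `t ^ τ +
(1 - t) ^ τ < 1` for `0 < t < 1 < τ`.

Along a ray the speed enters `J` only through `-ζ² ‖L_s^{1/2} u‖²`. Using the minimizer at one speed
as a competitor at another shows that `m` is strictly decreasing and that `m / (1 - ζ²)` is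
nondecreasing, which together give continuity; monotonicity gives differentiability almost
everywhere. Rotations make `d` radial, so a derivative along the ray yields a full gradient away
from the origin, and at the origin `d` is flat to second order.

The gradient comes from an envelope argument (`hasGradientAt_d`). With `φ` a ground state at `c`,
the function `c' ↦ κ (J(c'; φ) / K(φ)^{2/(p+1)})^α` lies above `d` and touches it at `c`, so where
`d` is differentiable the two gradients agree, and that of the upper function is the momentum. The
formula for `G₁` follows since least action states are ground states (`leastActionStates_subset`).
-/

/-! ### The `L²` Fourier transform: Fourier integrals, isometries, translations, conjugation -/

theorem integral_fourier_mul_eq {f g : Rn n → ℂ} (hf : Integrable f) (hg : Integrable g) :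
    ∫ x, 𝓕 f x * g x = ∫ x, f x * 𝓕 g x := by
  have h := VectorFourier.integral_fourierIntegral_smul_eq_flip (μ := (volume : Measure (Rn n)))
    (ν := (volume : Measure (Rn n))) (L := innerₗ (Rn n)) Real.continuous_fourierChar
    continuous_inner hf hg
  simpa [Real.fourier_eq, VectorFourier.fourierIntegral, flip_innerₗ] using h

theorem integral_fourierInv_mul_eq {f g : Rn n → ℂ} (hf : Integrable f) (hg : Integrable g) :
    ∫ x, 𝓕⁻ f x * g x = ∫ x, f x * 𝓕⁻ g x := by
  have h := integral_fourier_mul_eq hf hg.comp_neg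
  rw [Real.fourierInv_eq_fourier_comp_neg g, ← h, ← integral_neg_eq_self]
  simp [Real.fourierInv_eq_fourier_neg]

/-- An `L²` function whose tempered distribution is that of a locally integrable `g` equals `g`. -/
theorem ae_eq_of_forall_schwartz (f : L2C n) {g : Rn n → ℂ} (hg : LocallyIntegrable g)
    (h : ∀ φ : SchwartzMap (Rn n) ℂ, Lp.toTemperedDistribution f φ = ∫ x, φ x * g x) :
    f =ᵐ[volume] g := by
  refine ae_eq_of_integral_contDiff_smul_eq
    ((Lp.memLp f).locallyIntegrable (by norm_num)) hg fun φ hφ hc => ?_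
  have h1 : HasCompactSupport (Complex.ofRealCLM ∘ φ) := hc.comp_left rfl
  have h2 : ContDiff ℝ ((⊤ : ℕ∞) : WithTop ℕ∞) (Complex.ofRealCLM ∘ φ) :=
    Complex.ofRealCLM.contDiff.comp hφ
  have := h (h1.toSchwartzMap h2)
  simpa using this

theorem continuous_fourier_of_integrable {f : Rn n → ℂ} (hf : Integrable f) :
    Continuous (𝓕 f) :=
  VectorFourier.fourierIntegral_continuous Real.continuous_fourierChar continuous_inner hf

/-- On `L¹ ∩ L²` the `L²` Fourier transform is given by the Fourier integral. -/
theorem coeFn_fourier_of_integrable (f : L2C n) (hf : Integrable f) :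
    (𝓕 f : L2C n) =ᵐ[volume] 𝓕 (f : Rn n → ℂ) := by
  refine ae_eq_of_forall_schwartz _ (continuous_fourier_of_integrable hf).locallyIntegrable
    fun φ => ?_
  rw [← Lp.fourier_toTemperedDistribution_eq, TemperedDistribution.fourier_apply,
    Lp.toTemperedDistribution_apply, ← integral_fourier_mul_eq φ.integrable hf]
  simp [SchwartzMap.fourier_coe]

theorem continuous_fourierInv_of_integrable {f : Rn n → ℂ} (hf : Integrable f) :
    Continuous (𝓕⁻ f) := by
  rw [Real.fourierInv_eq_fourier_comp_neg]
  exact continuous_fourier_of_integrable hf.comp_neg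

theorem coeFn_fourierInv_of_integrable (f : L2C n) (hf : Integrable f) :
    (𝓕⁻ f : L2C n) =ᵐ[volume] 𝓕⁻ (f : Rn n → ℂ) := by
  refine ae_eq_of_forall_schwartz _ (continuous_fourierInv_of_integrable hf).locallyIntegrable
    fun φ => ?_
  rw [← Lp.fourierInv_toTemperedDistribution_eq, TemperedDistribution.fourierInv_apply,
    Lp.toTemperedDistribution_apply, ← integral_fourierInv_mul_eq φ.integrable hf]
  simp [SchwartzMap.fourierInv_coe]

/-- Two continuous maps on `L²` that agree on integrable functions are equal. -/
theorem eq_of_forall_integrable {X : Type*} [TopologicalSpace X] [T2Space X] {S T : L2C n → X}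
    (hS : Continuous S) (hT : Continuous T) (h : ∀ f : L2C n, Integrable f → S f = T f)
    (f : L2C n) : S f = T f := by
  refine DenseRange.induction_on (p := fun f => S f = T f)
    (SchwartzMap.denseRange_toLpCLM (E := Rn n) (F := ℂ) (p := 2) (μ := volume) (by norm_num)) f
    (isClosed_eq hS hT) fun φ => h _ ?_
  exact (φ.integrable (μ := volume)).congr (φ.coeFn_toLp 2 volume).symm

theorem continuous_fourier : Continuous (𝓕 : L2C n → L2C n) :=
  (Lp.fourierTransformₗᵢ (Rn n) ℂ).continuous

theorem continuous_fourierInv : Continuous (𝓕⁻ : L2C n → L2C n) :=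
  (Lp.fourierTransformₗᵢ (Rn n) ℂ).symm.continuous

/-- Composition with a linear isometry commutes with the Fourier transform. -/
theorem fourier_comp_isometry (A : Rn n ≃ₗᵢ[ℝ] Rn n) (f : L2C n) :
    𝓕 (Lp.compMeasurePreserving A A.measurePreserving f) =
      Lp.compMeasurePreserving A A.measurePreserving (𝓕 f) := by
  refine eq_of_forall_integrable
    (S := fun f => 𝓕 (Lp.compMeasurePreserving A A.measurePreserving f))
    (T := fun f => Lp.compMeasurePreserving A A.measurePreserving (𝓕 f))
    (continuous_fourier.comp (Lp.isometry_compMeasurePreserving A.measurePreserving).continuous)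
    ((Lp.isometry_compMeasurePreserving A.measurePreserving).continuous.comp continuous_fourier)
    (fun f hf => ?_) f
  have h1 := Lp.coeFn_compMeasurePreserving f A.measurePreserving
  have h2 : Integrable (Lp.compMeasurePreserving A A.measurePreserving f) :=
    ((A.measurePreserving.integrable_comp_emb
      A.toHomeomorph.measurableEmbedding).2 hf).congr h1.symm
  refine Lp.ext ((coeFn_fourier_of_integrable _ h2).trans ?_)
  refine Filter.EventuallyEq.trans ?_
    (Lp.coeFn_compMeasurePreserving (𝓕 f) A.measurePreserving).symm
  have h3 := A.measurePreserving.quasiMeasurePreserving.ae_eq_comp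
    (coeFn_fourier_of_integrable f hf)
  refine Filter.EventuallyEq.trans (Filter.Eventually.of_forall fun x => ?_) h3.symm
  rw [Real.fourier_congr_ae h1 x]
  exact Real.fourier_comp_linearIsometry A f x

/-- Translation of an `L²` function. -/
def translate {F : Type*} [NormedAddCommGroup F] (a : Rn n) (f : Lp F 2 (volume : Measure (Rn n))) :
    Lp F 2 (volume : Measure (Rn n)) :=
  Lp.compMeasurePreserving (· + a) (measurePreserving_add_right volume a) f

theorem coeFn_translate {F : Type*} [NormedAddCommGroup F] (a : Rn n)
    (f : Lp F 2 (volume : Measure (Rn n))) : translate a f =ᵐ[volume] fun x => f (x + a) :=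
  Lp.coeFn_compMeasurePreserving f (measurePreserving_add_right volume a)

/-- Multiplication of an `L²` function by a bounded function. -/
def mulL {σ : Rn n → ℂ} (hσ : MemLp σ ∞ volume) : L2C n →L[ℂ] L2C n :=
  (ContinuousLinearMap.mul ℂ ℂ).holderL volume ∞ 2 2 (hσ.toLp σ)

theorem coeFn_mulL {σ : Rn n → ℂ} (hσ : MemLp σ ∞ volume) (f : L2C n) :
    mulL hσ f =ᵐ[volume] fun ξ => σ ξ * f ξ := by
  filter_upwards [hσ.coeFn_toLp, (ContinuousLinearMap.mul ℂ ℂ).coeFn_holder (r := 2)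
    (hσ.toLp σ) f] with x h4 h5
  rw [← h4]
  exact h5

/-- The character `ξ ↦ e^{2πi a·ξ}`. -/
def char (a ξ : Rn n) : ℂ := 𝐞 (inner ℝ a ξ)

theorem continuous_char (a : Rn n) : Continuous (char a) :=
  continuous_subtype_val.comp (Real.continuous_fourierChar.comp (by fun_prop))

@[simp] theorem norm_char (a ξ : Rn n) : ‖char a ξ‖ = 1 := Circle.norm_coe _

theorem memLp_char (a : Rn n) : MemLp (char a) ∞ (volume : Measure (Rn n)) :=
  memLp_top_of_bound (continuous_char a).aestronglyMeasurable 1 (by simp)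

theorem fourier_translate (a : Rn n) (f : L2C n) :
    (𝓕 (translate a f) : L2C n) = mulL (memLp_char a) (𝓕 f) := by
  refine eq_of_forall_integrable
    (S := fun f => 𝓕 (translate a f)) (T := fun f => mulL (memLp_char a) (𝓕 f))
    (continuous_fourier.comp (Lp.isometry_compMeasurePreserving _).continuous)
    ((mulL (memLp_char a)).continuous.comp continuous_fourier) (fun f hf => ?_) f
  have h1 := coeFn_translate a f
  have h2 : Integrable (translate a f) := (hf.comp_add_right a).congr h1.symm
  refine Lp.ext ((coeFn_fourier_of_integrable _ h2).trans ?_)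
  filter_upwards [coeFn_fourier_of_integrable f hf, coeFn_mulL (memLp_char a) (𝓕 f)] with x h3 h4
  rw [h4, h3, Real.fourier_congr_ae h1 x]
  have := congrFun (VectorFourier.fourierIntegral_comp_add_right Real.fourierChar
    (volume : Measure (Rn n)) (innerₗ (Rn n)) f a) x
  simpa [Real.fourier_eq, VectorFourier.fourierIntegral, Circle.smul_def, char] using this

/-- Complex conjugation on `L²`. -/
def conjL : L2C n →L[ℝ] L2C n :=
  ContinuousLinearMap.compLpL 2 volume Complex.conjCLE.toContinuousLinearMap

theorem coeFn_conjL (f : L2C n) : conjL f =ᵐ[volume] fun x => (starRingEnd ℂ) (f x) :=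
  ContinuousLinearMap.coeFn_compLpL _ f

/-- Together with `coeFn_fourierInv` this shows which Fourier multipliers preserve real-valued
functions. -/
theorem fourier_conjL (f : L2C n) : 𝓕 (conjL f) = conjL (𝓕⁻ f) := by
  refine eq_of_forall_integrable (S := fun f => 𝓕 (conjL f)) (T := fun f => conjL (𝓕⁻ f))
    (continuous_fourier.comp conjL.continuous)
    (conjL.continuous.comp continuous_fourierInv) (fun f hf => ?_) f
  have h1 := coeFn_conjL f
  have h2 : Integrable (conjL f) := by
    refine Integrable.congr ?_ h1.symm
    exact Complex.conjCLE.toContinuousLinearMap.integrable_comp hf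
  refine Lp.ext ((coeFn_fourier_of_integrable _ h2).trans ?_)
  filter_upwards [coeFn_fourierInv_of_integrable f hf, coeFn_conjL (𝓕⁻ f)] with x h3 h4
  rw [h4, h3, Real.fourier_congr_ae h1 x, Real.fourier_eq, Real.fourierInv_eq, ← integral_conj]
  simp [Circle.smul_def, Real.fourierChar_apply, ← Complex.exp_conj, Complex.conj_ofNat]

theorem coeFn_fourierInv (f : L2C n) :
    (𝓕⁻ f : L2C n) =ᵐ[volume] fun x => (𝓕 f : L2C n) (-x) := by
  have key : 𝓕⁻ f = Lp.compMeasurePreserving (LinearIsometryEquiv.neg ℝ : Rn n ≃ₗᵢ[ℝ] Rn n)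
      (LinearIsometryEquiv.measurePreserving _) (𝓕 f) := by
    refine eq_of_forall_integrable (S := fun f => 𝓕⁻ f)
      (T := fun f => Lp.compMeasurePreserving (LinearIsometryEquiv.neg ℝ : Rn n ≃ₗᵢ[ℝ] Rn n)
        (LinearIsometryEquiv.measurePreserving _) (𝓕 f)) continuous_fourierInv
      ((Lp.isometry_compMeasurePreserving _).continuous.comp continuous_fourier) (fun f hf => ?_) f
    refine Lp.ext ((coeFn_fourierInv_of_integrable _ hf).trans ?_)
    have h3 := (LinearIsometryEquiv.measurePreserving
      (LinearIsometryEquiv.neg ℝ : Rn n ≃ₗᵢ[ℝ] Rn n)).quasiMeasurePreserving.ae_eq_comp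
      (coeFn_fourier_of_integrable f hf)
    filter_upwards [h3, Lp.coeFn_compMeasurePreserving (𝓕 f) (LinearIsometryEquiv.measurePreserving
      (LinearIsometryEquiv.neg ℝ : Rn n ≃ₗᵢ[ℝ] Rn n))] with x h4 h5
    rw [h5, h4, Real.fourierInv_eq_fourier_neg]
    rfl
  rw [key]
  exact Lp.coeFn_compMeasurePreserving _ _

/-- A Fourier multiplier whose symbol satisfies `σ(-ξ) = conj σ(ξ)` commutes with complex
conjugation. -/
theorem conjL_multiplier {σ : Rn n → ℂ} (hσ : MemLp σ ∞ volume)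
    (h : ∀ ξ, (starRingEnd ℂ) (σ (-ξ)) = σ ξ) (f : L2C n) :
    conjL (𝓕⁻ (mulL hσ (𝓕 f))) = 𝓕⁻ (mulL hσ (𝓕 (conjL f))) := by
  have hinj : Function.Injective (𝓕 : L2C n → L2C n) := (Lp.fourierTransformₗᵢ (Rn n) ℂ).injective
  refine hinj (Lp.ext ?_)
  rw [fourier_conjL, FourierTransform.fourier_fourierInv_eq, fourier_conjL]
  have hneg := (Measure.measurePreserving_neg (volume : Measure (Rn n))).quasiMeasurePreserving
  have h1 := hneg.ae_eq_comp (coeFn_mulL hσ (𝓕 f))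
  have h3 := coeFn_fourierInv (𝓕⁻ (mulL hσ (𝓕 f)))
  rw [FourierTransform.fourier_fourierInv_eq] at h3
  filter_upwards [h1, coeFn_conjL (𝓕⁻ (𝓕⁻ (mulL hσ (𝓕 f)))), h3,
    coeFn_mulL hσ (conjL (𝓕⁻ f)), coeFn_conjL (𝓕⁻ f), coeFn_fourierInv f] with x h1 h2 h3 h4 h5 h6
  rw [h2, h3, h4, h5, h6, ← h x, ← map_mul]
  exact congrArg _ h1

/-! ### Real-valued functions on the Fourier side, the operator `L_c^{1/2}` and the momentum -/

/-- The map `u ↦ û` from real-valued to complex-valued `L²`. -/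
def hatL : L2 n →L[ℝ] L2C n :=
  ((Lp.fourierTransformₗᵢ (Rn n) ℂ).toContinuousLinearEquiv :
    L2C n →L[ℂ] L2C n).restrictScalars ℝ ∘L Complex.ofRealCLM.compLpL 2 volume

theorem coeFn_toComplex (u : L2 n) : toComplex u =ᵐ[volume] fun x => (u x : ℂ) :=
  Complex.ofRealCLM.coeFn_compLp u

theorem norm_toComplex (u : L2 n) : ‖toComplex u‖ = ‖u‖ := by
  rw [Lp.norm_def, Lp.norm_def]
  congr 1
  refine eLpNorm_congr_norm_ae ?_
  filter_upwards [coeFn_toComplex u] with x hx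
  simp [hx]

theorem norm_hat (u : L2 n) : ‖hat u‖ = ‖u‖ := by
  rw [hat, Lp.norm_fourier_eq, norm_toComplex]

theorem hat_add (u v : L2 n) : hat (u + v) = hat u + hat v := hatL.map_add u v

theorem hat_sub (u v : L2 n) : hat (u - v) = hat u - hat v := hatL.map_sub u v

theorem hat_smul (t : ℝ) (u : L2 n) : hat (t • u) = t • hat u := hatL.map_smul t u

theorem hat_injective : Function.Injective (hat : L2 n → L2C n) := by
  intro u v h
  have h1 : ‖u - v‖ = 0 := by rw [← norm_hat, hat_sub, h, sub_self, norm_zero]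
  exact sub_eq_zero.1 (norm_eq_zero.1 h1)

theorem fourierInv_hat (u : L2 n) : 𝓕⁻ (hat u) = toComplex u :=
  FourierTransform.fourierInv_fourier_eq (toComplex u)

/-- The real part of a complex-valued `L²` function. -/
def reL : L2C n →L[ℝ] L2 n := Complex.reCLM.compLpL 2 volume

theorem toComplex_reL {f : L2C n} (hf : conjL f = f) : toComplex (reL f) = f := by
  refine Lp.ext ?_
  have h1 := coeFn_conjL f
  rw [hf] at h1
  filter_upwards [h1, coeFn_toComplex (reL f), Complex.reCLM.coeFn_compLpL f] with x h1 h2 h3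
  rw [h2]
  change ((Complex.reCLM.compLpL 2 volume f x : ℝ) : ℂ) = _
  rw [h3]
  exact Complex.conj_eq_iff_re.1 h1.symm

theorem conjL_toComplex (u : L2 n) : conjL (toComplex u) = toComplex u := by
  refine Lp.ext ?_
  filter_upwards [coeFn_conjL (toComplex u), coeFn_toComplex u] with x h1 h2
  rw [h1, h2, Complex.conj_ofReal]

theorem lhalfC_eq (c : Rn n) (f : L2C n) :
    lhalfC c f = 𝓕⁻ (mulL (halfSymbol_memLp c) (𝓕 f)) := rfl

theorem conj_halfSymbol_neg (c ξ : Rn n) :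
    (starRingEnd ℂ) (halfSymbol c (-ξ)) = halfSymbol c ξ := by
  simp only [halfSymbol, inner_neg_right, norm_neg, map_mul, Complex.conj_I, Complex.conj_ofReal]
  push_cast
  ring

/-- The symbol takes conjugate values at `ξ` and `-ξ`, so the multiplier commutes with conjugation
and the real part in `lhalf` discards nothing. -/
theorem toComplex_lhalf (c : Rn n) (u : L2 n) : toComplex (lhalf c u) = lhalfC c (toComplex u) := by
  refine toComplex_reL ?_
  rw [lhalfC_eq, conjL_multiplier _ (conj_halfSymbol_neg c), conjL_toComplex]

theorem hat_lhalf (c : Rn n) (u : L2 n) :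
    hat (lhalf c u) =ᵐ[volume] fun ξ => halfSymbol c ξ * hat u ξ := by
  rw [hat, toComplex_lhalf, lhalfC_eq, FourierTransform.fourier_fourierInv_eq]
  exact coeFn_mulL _ _

theorem norm_sq_eq_integral (f : L2C n) : ‖f‖ ^ 2 = ∫ ξ, ‖f ξ‖ ^ 2 := by
  rw [← real_inner_self_eq_norm_sq, L2.inner_def]
  simp

theorem integrable_norm_sq (f : L2C n) : Integrable fun ξ => ‖f ξ‖ ^ 2 :=
  (Lp.memLp f).integrable_norm_pow (by norm_num)

theorem norm_halfSymbol (c ξ : Rn n) : ‖halfSymbol c ξ‖ = |inner ℝ c ξ| / ‖ξ‖ := by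
  simp only [halfSymbol, norm_mul, Complex.norm_I, one_mul, Complex.norm_real,
    Real.norm_eq_abs, abs_div, abs_norm]

theorem norm_halfSymbol_le (c ξ : Rn n) : ‖halfSymbol c ξ‖ ≤ ‖c‖ := by
  rw [norm_halfSymbol]
  exact div_le_of_le_mul₀ (norm_nonneg _) (norm_nonneg _) (abs_real_inner_le_norm c ξ)

theorem halfSymbol_add (c d ξ : Rn n) : halfSymbol (c + d) ξ = halfSymbol c ξ + halfSymbol d ξ := by
  simp only [halfSymbol, inner_add_left, add_div]
  push_cast
  ring

theorem halfSymbol_smul (t : ℝ) (c ξ : Rn n) : halfSymbol (t • c) ξ = t * halfSymbol c ξ := by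
  simp only [halfSymbol, real_inner_smul_left, mul_div_assoc]
  push_cast
  ring

theorem lhalf_add_left (c d : Rn n) (u : L2 n) : lhalf (c + d) u = lhalf c u + lhalf d u := by
  refine hat_injective (Lp.ext ?_)
  rw [hat_add]
  filter_upwards [hat_lhalf (c + d) u, hat_lhalf c u, hat_lhalf d u,
    Lp.coeFn_add (hat (lhalf c u)) (hat (lhalf d u))] with ξ h1 h2 h3 h4
  rw [h1, h4, Pi.add_apply, h2, h3, halfSymbol_add, add_mul]

theorem lhalf_smul_left (t : ℝ) (c : Rn n) (u : L2 n) : lhalf (t • c) u = t • lhalf c u := by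
  refine hat_injective (Lp.ext ?_)
  rw [hat_smul]
  filter_upwards [hat_lhalf (t • c) u, hat_lhalf c u,
    Lp.coeFn_smul t (hat (lhalf c u))] with ξ h1 h2 h4
  rw [h1, h4, Pi.smul_apply, h2, halfSymbol_smul, mul_assoc]
  rfl

/-- The operator `L_c^{1/2} u`, as a linear map in `c`. -/
def lhalfLeft (u : L2 n) : Rn n →L[ℝ] L2 n :=
  LinearMap.toContinuousLinearMap
    { toFun := fun c => lhalf c u
      map_add' := fun c d => lhalf_add_left c d u
      map_smul' := fun t c => lhalf_smul_left t c u }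

@[simp] theorem lhalfLeft_apply (u : L2 n) (c : Rn n) : lhalfLeft u c = lhalf c u := rfl

theorem norm_sq_lhalf (c : Rn n) (u : L2 n) :
    ‖lhalf c u‖ ^ 2 = ∫ ξ, ‖halfSymbol c ξ‖ ^ 2 * ‖hat u ξ‖ ^ 2 := by
  rw [← norm_hat, norm_sq_eq_integral]
  refine integral_congr_ae ?_
  filter_upwards [hat_lhalf c u] with ξ h
  rw [h, norm_mul, mul_pow]

/-- The inner product of a vector with the momentum. -/
theorem inner_momentum (c : Rn n) (w : L2 n × L2 n) :
    inner ℝ c (momentum w) = inner ℝ w.2 (lhalf c w.1) := by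
  have h1 : ∀ j, momentum w j = inner ℝ w.2 (lhalf (EuclideanSpace.single j 1) w.1) := by
    intro j
    rw [L2.inner_def]
    simp [momentum, mul_comm]
  have h2 : lhalf c w.1 = ∑ j, c j • lhalf (EuclideanSpace.single j (1 : ℝ)) w.1 := by
    simp only [← lhalfLeft_apply]
    conv_lhs => rw [← (EuclideanSpace.basisFun (Fin n) ℝ).sum_repr c]
    simp
  rw [h2, inner_sum, PiLp.inner_apply]
  refine Finset.sum_congr rfl fun j _ => ?_
  rw [h1, inner_smul_right]
  simp [mul_comm]

/-! ### The space `H¹` and the quadratic form `J` on the Fourier side -/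

/-- The symbol `√(1 + |ξ|²)`. -/
def bessel (ξ : Rn n) : ℝ := √(1 + ‖ξ‖ ^ 2)

theorem continuous_bessel : Continuous fun ξ : Rn n => (bessel ξ : ℂ) := by
  unfold bessel
  fun_prop

/-- The Sobolev condition asks for some `L²` function representing a distribution. That distribution
is also given by the locally integrable function `bessel * û`, and testing against bump functions
identifies the two almost everywhere. -/
theorem memH1_iff (u : L2 n) : MemH1 u ↔ MemLp (fun ξ => (bessel ξ : ℂ) * hat u ξ) 2 := by
  have hb : ∀ ξ : Rn n, (1 + ‖ξ‖ ^ 2) ^ ((1 : ℝ) / 2) = bessel ξ := fun ξ => by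
    rw [bessel, Real.sqrt_eq_rpow]
  have hg : (fun ξ : Rn n => (((1 + ‖ξ‖ ^ 2) ^ ((1 : ℝ) / 2) : ℝ) : ℂ)).HasTemperateGrowth := by
    fun_prop
  rw [MemH1, TemperedDistribution.memSobolev_iff_exists_smulLeftCLM_fourier,
    Lp.fourier_toTemperedDistribution_eq]
  have hli : LocallyIntegrable (fun ξ => (bessel ξ : ℂ) * hat u ξ) := by
    have h1 : LocallyIntegrable (hat u) := (Lp.memLp (hat u)).locallyIntegrable (by norm_num)
    rw [← locallyIntegrableOn_univ] at h1 ⊢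
    exact h1.continuousOn_mul (continuous_bessel.continuousOn) isOpen_univ.isLocallyClosed
  have key : ∀ φ : SchwartzMap (Rn n) ℂ, (TemperedDistribution.smulLeftCLM ℂ
      (fun ξ : Rn n => (((1 + ‖ξ‖ ^ 2) ^ ((1 : ℝ) / 2) : ℝ) : ℂ))
      (Lp.toTemperedDistribution (hat u))) φ = ∫ ξ, φ ξ * ((bessel ξ : ℂ) * hat u ξ) := by
    intro φ
    rw [TemperedDistribution.smulLeftCLM_apply_apply, Lp.toTemperedDistribution_apply]
    refine integral_congr_ae (Eventually.of_forall fun ξ => ?_)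
    simp only [SchwartzMap.smulLeftCLM_apply_apply hg, smul_eq_mul]
    rw [hb]
    ring
  constructor
  · rintro ⟨f, hf⟩
    refine (Lp.memLp f).ae_eq (ae_eq_of_forall_schwartz f hli fun φ => ?_)
    rw [← hf]
    exact key φ
  · intro h
    refine ⟨h.toLp _, ?_⟩
    ext φ
    rw [Lp.toTemperedDistribution_apply]
    refine (key φ).trans (integral_congr_ae ?_)
    filter_upwards [h.coeFn_toLp] with ξ hξ
    rw [hξ, smul_eq_mul]

theorem coeFn_hat_add (u v : L2 n) : hat (u + v) =ᵐ[volume] fun ξ => hat u ξ + hat v ξ := by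
  rw [hat_add]
  exact Lp.coeFn_add _ _

theorem coeFn_hat_smul (t : ℝ) (u : L2 n) : hat (t • u) =ᵐ[volume] fun ξ => (t : ℂ) * hat u ξ := by
  rw [hat_smul]
  exact Lp.coeFn_smul _ _

theorem MemH1.add {u v : L2 n} (hu : MemH1 u) (hv : MemH1 v) : MemH1 (u + v) := by
  rw [memH1_iff] at *
  refine (hu.add hv).ae_eq ?_
  filter_upwards [coeFn_hat_add u v] with ξ h
  rw [h, Pi.add_apply, mul_add]

theorem MemH1.smul {u : L2 n} (hu : MemH1 u) (t : ℝ) : MemH1 (t • u) := by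
  rw [memH1_iff] at *
  refine (hu.const_mul (t : ℂ)).ae_eq ?_
  filter_upwards [coeFn_hat_smul t u] with ξ h
  rw [h]
  ring

theorem MemH1.sub {u v : L2 n} (hu : MemH1 u) (hv : MemH1 v) : MemH1 (u - v) := by
  have := hu.add (hv.smul (-1))
  rwa [neg_smul, one_smul, ← sub_eq_add_neg] at this

theorem memH1_iff_integrable (u : L2 n) :
    MemH1 u ↔ Integrable fun ξ => (1 + ‖ξ‖ ^ 2) * ‖hat u ξ‖ ^ 2 := by
  have hm : AEStronglyMeasurable (fun ξ => (bessel ξ : ℂ) * hat u ξ) volume :=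
    continuous_bessel.aestronglyMeasurable.mul (Lp.aestronglyMeasurable _)
  rw [memH1_iff, memLp_two_iff_integrable_sq_norm hm]
  have : ∀ ξ : Rn n, ‖(bessel ξ : ℂ) * hat u ξ‖ ^ 2 = (1 + ‖ξ‖ ^ 2) * ‖hat u ξ‖ ^ 2 := by
    intro ξ
    rw [norm_mul, mul_pow, Complex.norm_real, bessel, Real.norm_eq_abs, sq_abs,
      Real.sq_sqrt (by positivity)]
  simp only [this]

/-- The squared `H¹` norm `∫ (1 + |ξ|²) |û|²`. -/
def sobolevSq (u : L2 n) : ℝ := ∫ ξ, (1 + ‖ξ‖ ^ 2) * ‖hat u ξ‖ ^ 2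

theorem sobolevSq_nonneg (u : L2 n) : 0 ≤ sobolevSq u :=
  integral_nonneg fun ξ => by positivity

theorem norm_sq_eq_integral_hat (u : L2 n) : ‖u‖ ^ 2 = ∫ ξ, ‖hat u ξ‖ ^ 2 := by
  rw [← norm_hat, norm_sq_eq_integral]

theorem norm_sq_le_sobolevSq {u : L2 n} (hu : MemH1 u) : ‖u‖ ^ 2 ≤ sobolevSq u := by
  rw [norm_sq_eq_integral_hat]
  refine integral_mono (integrable_norm_sq _) ((memH1_iff_integrable u).1 hu) fun ξ => ?_
  nlinarith [mul_nonneg (sq_nonneg ‖ξ‖) (sq_nonneg ‖hat u ξ‖)]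

/-- The symbol `|2πξ|² + 1 - (c·ξ)²/|ξ|²` of the quadratic form `2 J`. -/
def weight (c ξ : Rn n) : ℝ := (2 * Real.pi * ‖ξ‖) ^ 2 + 1 - ‖halfSymbol c ξ‖ ^ 2

theorem measurable_halfSymbol (c : Rn n) : Measurable (halfSymbol c) := by
  unfold halfSymbol
  fun_prop

theorem measurable_weight (c : Rn n) : Measurable (weight c) := by
  have := measurable_halfSymbol c
  unfold weight
  fun_prop

/-- Coercivity: `|c·ξ|/|ξ| ≤ |c|` and `2π ≥ 1`. For `|c| < 1` the form `J` therefore controls the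
`H¹` norm. -/
theorem le_weight (c ξ : Rn n) : (1 - ‖c‖ ^ 2) * (1 + ‖ξ‖ ^ 2) ≤ weight c ξ := by
  have h1 : ‖halfSymbol c ξ‖ ^ 2 ≤ ‖c‖ ^ 2 := by
    gcongr
    exact norm_halfSymbol_le c ξ
  have h2 : ‖ξ‖ ^ 2 ≤ (2 * Real.pi * ‖ξ‖) ^ 2 := by
    gcongr
    nlinarith [Real.pi_gt_three, norm_nonneg ξ]
  unfold weight
  nlinarith [mul_nonneg (sq_nonneg ‖c‖) (sq_nonneg ‖ξ‖)]

theorem weight_pos {c : Rn n} (hc : ‖c‖ < 1) (ξ : Rn n) : 0 < weight c ξ := by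
  refine lt_of_lt_of_le ?_ (le_weight c ξ)
  have : ‖c‖ ^ 2 < 1 := by nlinarith [norm_nonneg c]
  have : 0 < 1 - ‖c‖ ^ 2 := by linarith
  positivity

theorem integrable_grad {u : L2 n} (hu : MemH1 u) :
    Integrable fun ξ => (2 * Real.pi * ‖ξ‖) ^ 2 * ‖hat u ξ‖ ^ 2 := by
  have h := (((memH1_iff_integrable u).1 hu).sub (integrable_norm_sq (hat u))).const_mul
    ((2 * Real.pi) ^ 2)
  refine h.congr (Eventually.of_forall fun ξ => ?_)
  simp only [Pi.sub_apply]
  ring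

theorem integrable_halfSymbol (c : Rn n) (u : L2 n) :
    Integrable fun ξ => ‖halfSymbol c ξ‖ ^ 2 * ‖hat u ξ‖ ^ 2 := by
  refine (integrable_norm_sq (hat (lhalf c u))).congr ?_
  filter_upwards [hat_lhalf c u] with ξ h
  rw [h, norm_mul, mul_pow]

theorem integrable_weight {u : L2 n} (hu : MemH1 u) (c : Rn n) :
    Integrable fun ξ => weight c ξ * ‖hat u ξ‖ ^ 2 := by
  refine (((integrable_grad hu).add (integrable_norm_sq (hat u))).sub
    (integrable_halfSymbol c u)).congr (Eventually.of_forall fun ξ => ?_)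
  simp only [Pi.sub_apply, Pi.add_apply, weight]
  ring

theorem two_mul_J {u : L2 n} (hu : MemH1 u) (c : Rn n) :
    2 * J c u = ∫ ξ, weight c ξ * ‖hat u ξ‖ ^ 2 := by
  have h : ∫ ξ, weight c ξ * ‖hat u ξ‖ ^ 2 = gradSq u + ‖u‖ ^ 2 - ‖lhalf c u‖ ^ 2 := by
    rw [gradSq, norm_sq_eq_integral_hat, norm_sq_lhalf,
      ← integral_add (integrable_grad hu) (integrable_norm_sq _)]
    refine Eq.trans (integral_congr_ae (Eventually.of_forall fun ξ => ?_))
      (integral_sub ((integrable_grad hu).add (integrable_norm_sq _)) (integrable_halfSymbol c u))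
    simp only [weight]
    ring
  rw [h, J]
  ring

theorem sobolevSq_le_J {u : L2 n} (hu : MemH1 u) (c : Rn n) :
    (1 - ‖c‖ ^ 2) * sobolevSq u ≤ 2 * J c u := by
  rw [two_mul_J hu, sobolevSq, ← integral_const_mul]
  refine integral_mono (((memH1_iff_integrable u).1 hu).const_mul _) (integrable_weight hu c)
    fun ξ => ?_
  change _ * (_ * _) ≤ _
  rw [← mul_assoc]
  exact mul_le_mul_of_nonneg_right (le_weight c ξ) (by positivity)

theorem J_nonneg {u : L2 n} (hu : MemH1 u) {c : Rn n} (hc : ‖c‖ < 1) : 0 ≤ J c u := by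
  have h := sobolevSq_le_J hu c
  have : 0 ≤ 1 - ‖c‖ ^ 2 := by nlinarith [norm_nonneg c]
  nlinarith [mul_nonneg this (sobolevSq_nonneg u)]

theorem J_pos {u : L2 n} (hu : MemH1 u) (h0 : u ≠ 0) {c : Rn n} (hc : ‖c‖ < 1) : 0 < J c u := by
  have h := sobolevSq_le_J hu c
  have h1 : 0 < 1 - ‖c‖ ^ 2 := by nlinarith [norm_nonneg c]
  have h2 := norm_sq_le_sobolevSq hu
  have h3 : 0 < ‖u‖ ^ 2 := by have := norm_pos_iff.2 h0; positivity
  nlinarith [mul_pos h1 (h3.trans_le h2)]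

/-- `f` is the `L²` function `√(weight c) û`, whose squared norm is `2 J(u)`. -/
def IsWeighted (c : Rn n) (u : L2 n) (f : L2C n) : Prop :=
  f =ᵐ[volume] fun ξ => (√(weight c ξ) : ℂ) * hat u ξ

/-- This realizes `2 J` as the squared norm of a Hilbert space, so that expansions of `J` and weak
compactness are those of `L²`. -/
theorem exists_isWeighted {u : L2 n} (hu : MemH1 u) {c : Rn n} (hc : ‖c‖ < 1) :
    ∃ f, IsWeighted c u f := by
  have hm : AEStronglyMeasurable (fun ξ => (√(weight c ξ) : ℂ) * hat u ξ) := by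
    refine AEStronglyMeasurable.mul ?_ (Lp.aestronglyMeasurable _)
    have := measurable_weight c
    exact (by fun_prop : Measurable fun ξ => (√(weight c ξ) : ℂ)).aestronglyMeasurable
  have : MemLp (fun ξ => (√(weight c ξ) : ℂ) * hat u ξ) 2 := by
    rw [memLp_two_iff_integrable_sq_norm hm]
    refine (integrable_weight hu c).congr (Eventually.of_forall fun ξ => ?_)
    simp only [norm_mul, mul_pow, Complex.norm_real, Real.norm_eq_abs, sq_abs,
      Real.sq_sqrt (weight_pos hc ξ).le]
  exact ⟨this.toLp _, this.coeFn_toLp⟩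

theorem IsWeighted.norm_sq {u : L2 n} {c : Rn n} {f : L2C n} (h : IsWeighted c u f)
    (hu : MemH1 u) (hc : ‖c‖ < 1) : ‖f‖ ^ 2 = 2 * J c u := by
  rw [two_mul_J hu, norm_sq_eq_integral]
  refine integral_congr_ae ?_
  filter_upwards [h] with ξ hξ
  rw [hξ]
  simp only [norm_mul, mul_pow, Complex.norm_real, Real.norm_eq_abs, sq_abs,
      Real.sq_sqrt (weight_pos hc ξ).le]

theorem IsWeighted.add_smul {u v : L2 n} {c : Rn n} {f g : L2C n} (hf : IsWeighted c u f)
    (hg : IsWeighted c v g) (t : ℝ) : IsWeighted c (u + t • v) (f + t • g) := by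
  filter_upwards [hf, hg, coeFn_hat_add u (t • v), coeFn_hat_smul t v, Lp.coeFn_add f (t • g),
    Lp.coeFn_smul t g] with ξ h1 h2 h3 h4 h5 h6
  rw [h5, Pi.add_apply, h6, Pi.smul_apply, h1, h2, h3, h4, Complex.real_smul]
  ring

theorem IsWeighted.sub {u v : L2 n} {c : Rn n} {f g : L2C n} (hf : IsWeighted c u f)
    (hg : IsWeighted c v g) : IsWeighted c (u - v) (f - g) := by
  simpa [sub_eq_add_neg] using hf.add_smul hg (-1)

theorem exists_J_add_smul {u v : L2 n} (hu : MemH1 u) (hv : MemH1 v) {c : Rn n} (hc : ‖c‖ < 1) :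
    ∃ B, ∀ t : ℝ, J c (u + t • v) = J c u + t * B + t ^ 2 * J c v := by
  obtain ⟨f, hf⟩ := exists_isWeighted hu hc
  obtain ⟨g, hg⟩ := exists_isWeighted hv hc
  refine ⟨inner ℝ f g, fun t => ?_⟩
  have h := (hf.add_smul hg t).norm_sq (hu.add (hv.smul t)) hc
  rw [norm_add_sq_real, hf.norm_sq hu hc, norm_smul, mul_pow, hg.norm_sq hv hc,
    inner_smul_right, Real.norm_eq_abs, sq_abs] at h
  linarith

theorem J_smul {u : L2 n} (c : Rn n) (t : ℝ) : J c (t • u) = t ^ 2 * J c u := by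
  have h1 : gradSq (t • u) = t ^ 2 * gradSq u := by
    rw [gradSq, gradSq, ← integral_const_mul]
    refine integral_congr_ae ?_
    filter_upwards [coeFn_hat_smul t u] with ξ h
    rw [h, norm_mul, mul_pow ‖(t : ℂ)‖, Complex.norm_real, Real.norm_eq_abs, sq_abs]
    ring
  have h2 : ‖lhalf c (t • u)‖ ^ 2 = t ^ 2 * ‖lhalf c u‖ ^ 2 := by
    rw [norm_sq_lhalf, norm_sq_lhalf, ← integral_const_mul]
    refine integral_congr_ae ?_
    filter_upwards [coeFn_hat_smul t u] with ξ h
    rw [h, norm_mul, mul_pow ‖(t : ℂ)‖, Complex.norm_real, Real.norm_eq_abs, sq_abs]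
    ring
  rw [J, J, h1, h2, norm_smul, mul_pow, Real.norm_eq_abs, sq_abs]
  ring

/-- `J` depends only on `|û|`. -/
theorem J_congr {u v : L2 n} (h : ∀ᵐ ξ, ‖hat u ξ‖ = ‖hat v ξ‖) (c : Rn n) : J c u = J c v := by
  have h1 : gradSq u = gradSq v := integral_congr_ae (h.mono fun ξ hξ => by simp only [hξ])
  have h2 : ‖u‖ ^ 2 = ‖v‖ ^ 2 := by
    rw [norm_sq_eq_integral_hat, norm_sq_eq_integral_hat]
    exact integral_congr_ae (h.mono fun ξ hξ => by simp only [hξ])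
  have h3 : ‖lhalf c u‖ ^ 2 = ‖lhalf c v‖ ^ 2 := by
    rw [norm_sq_lhalf, norm_sq_lhalf]
    exact integral_congr_ae (h.mono fun ξ hξ => by simp only [hξ])
  rw [J, J, h1, h2, h3]

theorem memH1_congr {u v : L2 n} (h : ∀ᵐ ξ, ‖hat u ξ‖ = ‖hat v ξ‖) (hu : MemH1 u) : MemH1 v := by
  rw [memH1_iff_integrable] at *
  exact hu.congr (h.mono fun ξ hξ => by simp only [hξ])

/-- If `c ≠ 0`, the operator `L_c^{1/2}` is injective on `L²`. -/
theorem lhalf_ne_zero {c : Rn n} (hc : c ≠ 0) {u : L2 n} (hu : u ≠ 0) : lhalf c u ≠ 0 := by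
  intro h0
  have h1 := hat_lhalf c u
  have h2 : hat (lhalf c u) = 0 := by rw [h0]; exact hatL.map_zero
  have h3 : ∀ᵐ ξ : Rn n, inner ℝ c ξ ≠ 0 := by
    have hs : (innerSL ℝ c : Rn n →L[ℝ] ℝ).ker ≠ ⊤ := by
      intro htop
      have : c ∈ (innerSL ℝ c : Rn n →L[ℝ] ℝ).ker := by rw [htop]; trivial
      simp [LinearMap.mem_ker] at this
      exact hc this
    have := Measure.addHaar_submodule (volume : Measure (Rn n)) _ hs
    rw [ae_iff]
    convert this using 2
    ext ξ
    simp [LinearMap.mem_ker]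
  refine hu (hat_injective ?_)
  rw [show hat (0 : L2 n) = 0 from hatL.map_zero]
  refine Lp.ext ?_
  rw [h2] at h1
  filter_upwards [h1, h3, Lp.coeFn_zero ℂ 2 (volume : Measure (Rn n))] with ξ h1 h3 h4
  rw [h4] at h1 ⊢
  have h5 : halfSymbol c ξ ≠ 0 := by
    have : ξ ≠ 0 := by rintro rfl; simp at h3
    rw [← norm_ne_zero_iff, norm_halfSymbol]
    have := norm_pos_iff.2 this
    positivity
  exact (mul_eq_zero.1 h1.symm).resolve_left h5

/-! ### Invariance under translations and rotations -/

theorem K_congr_comp (p : ℝ) {T : Rn n → Rn n} (hT : MeasurePreserving T)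
    (hT' : MeasurableEmbedding T) {u v : L2 n} (h : v =ᵐ[volume] fun x => u (T x)) :
    K p v = K p u := by
  rw [K, K, ← hT.integral_comp hT' (fun x => |u x| ^ (p + 1))]
  congr 1
  exact integral_congr_ae (h.mono fun x hx => by simp only [hx])

theorem K_translate (p : ℝ) (a : Rn n) (u : L2 n) : K p (translate a u) = K p u :=
  K_congr_comp p (measurePreserving_add_right volume a) (measurableEmbedding_addRight a)
    (coeFn_translate a u)

theorem toComplex_translate (a : Rn n) (u : L2 n) :
    toComplex (translate a u) = translate a (toComplex u) := by
  refine Lp.ext ?_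
  have h1 := (measurePreserving_add_right (volume : Measure (Rn n)) a).quasiMeasurePreserving.ae_eq_comp
    (coeFn_toComplex u)
  filter_upwards [h1, coeFn_toComplex (translate a u), coeFn_translate a u,
    coeFn_translate a (toComplex u)] with x h1 h2 h3 h4
  rw [h2, h3, h4]
  exact h1.symm

theorem hat_translate (a : Rn n) (u : L2 n) :
    hat (translate a u) =ᵐ[volume] fun ξ => char a ξ * hat u ξ := by
  rw [hat, toComplex_translate, fourier_translate]
  exact coeFn_mulL _ _

theorem norm_hat_translate (a : Rn n) (u : L2 n) :
    ∀ᵐ ξ, ‖hat (translate a u) ξ‖ = ‖hat u ξ‖ := by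
  filter_upwards [hat_translate a u] with ξ h
  rw [h, norm_mul, norm_char, one_mul]

theorem J_translate (c a : Rn n) (u : L2 n) : J c (translate a u) = J c u :=
  J_congr (norm_hat_translate a u) c

theorem MemH1.translate {u : L2 n} (hu : MemH1 u) (a : Rn n) : MemH1 (translate a u) :=
  memH1_congr ((norm_hat_translate a u).mono fun _ h => h.symm) hu

/-- Composition of an `L²` function with a linear isometry. -/
def rotate (A : Rn n ≃ₗᵢ[ℝ] Rn n) (u : L2 n) : L2 n :=
  Lp.compMeasurePreserving A A.measurePreserving u

theorem coeFn_rotate (A : Rn n ≃ₗᵢ[ℝ] Rn n) (u : L2 n) :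
    rotate A u =ᵐ[volume] fun x => u (A x) :=
  Lp.coeFn_compMeasurePreserving u A.measurePreserving

theorem K_rotate (p : ℝ) (A : Rn n ≃ₗᵢ[ℝ] Rn n) (u : L2 n) : K p (rotate A u) = K p u :=
  K_congr_comp p A.measurePreserving A.toHomeomorph.measurableEmbedding (coeFn_rotate A u)

theorem hat_rotate (A : Rn n ≃ₗᵢ[ℝ] Rn n) (u : L2 n) :
    hat (rotate A u) =ᵐ[volume] fun ξ => hat u (A ξ) := by
  have h : toComplex (rotate A u) =
      Lp.compMeasurePreserving A A.measurePreserving (toComplex u) := by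
    refine Lp.ext ?_
    have h1 := A.measurePreserving.quasiMeasurePreserving.ae_eq_comp (coeFn_toComplex u)
    filter_upwards [h1, coeFn_toComplex (rotate A u), coeFn_rotate A u,
      Lp.coeFn_compMeasurePreserving (toComplex u) A.measurePreserving] with x h1 h2 h3 h4
    rw [h2, h3, h4]
    exact h1.symm
  rw [hat, h, fourier_comp_isometry]
  exact Lp.coeFn_compMeasurePreserving _ A.measurePreserving

theorem MemH1.rotate {u : L2 n} (hu : MemH1 u) (A : Rn n ≃ₗᵢ[ℝ] Rn n) : MemH1 (rotate A u) := by
  rw [memH1_iff_integrable] at *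
  have := (A.measurePreserving.integrable_comp_emb A.toHomeomorph.measurableEmbedding).2 hu
  refine this.congr ?_
  filter_upwards [hat_rotate A u] with ξ h
  simp [h]

theorem weight_isometry (A : Rn n ≃ₗᵢ[ℝ] Rn n) (c ξ : Rn n) : weight (A c) (A ξ) = weight c ξ := by
  simp [weight, norm_halfSymbol]

theorem J_rotate {u : L2 n} (hu : MemH1 u) (A : Rn n ≃ₗᵢ[ℝ] Rn n) (c : Rn n) :
    J c (rotate A u) = J (A c) u := by
  have h : 2 * J c (rotate A u) = 2 * J (A c) u := by
    rw [two_mul_J (hu.rotate A), two_mul_J hu, ← A.measurePreserving.integral_comp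
      A.toHomeomorph.measurableEmbedding (fun ξ => weight (A c) ξ * ‖hat u ξ‖ ^ 2)]
    refine integral_congr_ae ?_
    filter_upwards [hat_rotate A u] with ξ h
    rw [h, weight_isometry]
  linarith

theorem image_J_isometry_subset (p : ℝ) (A : Rn n ≃ₗᵢ[ℝ] Rn n) (c : Rn n) :
    J (A c) '' {u : L2 n | MemH1 u ∧ K p u = 1} ⊆ J c '' {u : L2 n | MemH1 u ∧ K p u = 1} := by
  rintro _ ⟨u, ⟨hu, hK⟩, rfl⟩
  exact ⟨rotate A u, ⟨hu.rotate A, by rw [K_rotate, hK]⟩, J_rotate hu A c⟩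

theorem mInf_isometry (p : ℝ) (A : Rn n ≃ₗᵢ[ℝ] Rn n) (c : Rn n) : mInf p (A c) = mInf p c := by
  have h := image_J_isometry_subset p A.symm (A c)
  rw [A.symm_apply_apply] at h
  rw [mInf, mInf, (image_J_isometry_subset p A c).antisymm h]

/-- `m(c)` depends only on `|c|`. -/
theorem mInf_eq_of_norm_eq (p : ℝ) {c c' : Rn n} (h : ‖c‖ = ‖c'‖) : mInf p c = mInf p c' := by
  -- The reflection in the hyperplane orthogonal to `c - c'` maps `c` to `c'`, the norms being
  -- equal.
  have := mInf_isometry p ((ℝ ∙ (c - c'))ᗮ.reflection) c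
  rw [Submodule.reflection_sub h] at this
  exact this.symm

/-! ### Frequency cutoffs and the subcritical Sobolev embedding -/

/-- The restriction of an `L²` function to the ball of radius `R`. -/
def cut (R : ℝ) : L2C n →L[ℂ] L2C n :=
  mulL (σ := (Metric.ball 0 R).indicator fun _ => 1)
    ((memLp_top_const 1).indicator measurableSet_ball)

theorem coeFn_cut (R : ℝ) (f : L2C n) :
    cut R f =ᵐ[volume] (Metric.ball 0 R).indicator f := by
  filter_upwards [coeFn_mulL (σ := (Metric.ball (0 : Rn n) R).indicator fun _ => 1)
    ((memLp_top_const 1).indicator measurableSet_ball) f] with ξ h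
  refine h.trans ?_
  by_cases hξ : ξ ∈ Metric.ball (0 : Rn n) R <;> simp [hξ]

theorem memLp_lowKernel (R : ℝ) (x : Rn n) :
    MemLp ((Metric.ball 0 R).indicator fun ξ => (starRingEnd ℂ) (char x ξ)) 2 volume := by
  have : IsFiniteMeasure (volume.restrict (Metric.ball (0 : Rn n) R)) :=
    isFiniteMeasure_restrict.2 measure_ball_lt_top.ne
  rw [memLp_indicator_iff_restrict measurableSet_ball]
  refine MemLp.of_bound (Continuous.aestronglyMeasurable ?_) 1 (by simp)
  exact Complex.continuous_conj.comp (continuous_char x)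

/-- The function `1_{|ξ| < R} e^{-2πi x·ξ}`. -/
def lowKernel (R : ℝ) (x : Rn n) : L2C n := (memLp_lowKernel R x).toLp _

/-- The value at `x` of the inverse Fourier transform of `1_{|ξ| < R} f`. -/
def low (R : ℝ) (x : Rn n) : L2C n →L[ℂ] ℂ := innerSL ℂ (lowKernel R x)

theorem low_apply (R : ℝ) (x : Rn n) (f : L2C n) :
    low R x f = ∫ ξ in Metric.ball 0 R, char x ξ * f ξ := by
  change inner ℂ (lowKernel R x) f = _
  rw [L2.inner_def, ← integral_indicator measurableSet_ball]
  refine integral_congr_ae ?_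
  filter_upwards [(memLp_lowKernel R x).coeFn_toLp] with ξ h
  rw [lowKernel, h]
  by_cases hξ : ξ ∈ Metric.ball (0 : Rn n) R <;> simp [hξ, mul_comm]

theorem norm_lowKernel (R : ℝ) (x : Rn n) :
    ‖lowKernel R x‖ = √(volume.real (Metric.ball (0 : Rn n) R)) := by
  rw [← Real.sqrt_sq (norm_nonneg (lowKernel R x)), norm_sq_eq_integral]
  congr 1
  rw [← integral_indicator_one measurableSet_ball]
  refine integral_congr_ae ?_
  filter_upwards [(memLp_lowKernel R x).coeFn_toLp] with ξ h
  rw [lowKernel, h]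
  by_cases hξ : ξ ∈ Metric.ball (0 : Rn n) R <;> simp [hξ]

theorem norm_low_le (R : ℝ) (x : Rn n) (f : L2C n) :
    ‖low R x f‖ ≤ √(volume.real (Metric.ball (0 : Rn n) R)) * ‖f‖ := by
  rw [← norm_lowKernel R x]
  exact norm_inner_le_norm (𝕜 := ℂ) (lowKernel R x) f

theorem integrable_cut (R : ℝ) (f : L2C n) : Integrable (cut R f) := by
  refine Integrable.congr ?_ (coeFn_cut R f).symm
  rw [integrable_indicator_iff measurableSet_ball]
  have : IsFiniteMeasure (volume.restrict (Metric.ball (0 : Rn n) R)) :=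
    isFiniteMeasure_restrict.2 measure_ball_lt_top.ne
  exact ((Lp.memLp f).restrict _).integrable (by norm_num)

/-- The right side is defined for every `x` and is, for each `x`, a continuous linear functional of
`f`. Weak convergence in `L²` thus becomes pointwise convergence of low-frequency parts. -/
theorem coeFn_fourierInv_cut (R : ℝ) (f : L2C n) :
    (𝓕⁻ (cut R f) : L2C n) =ᵐ[volume] fun x => low R x f := by
  filter_upwards [coeFn_fourierInv_of_integrable _ (integrable_cut R f)] with x h
  rw [h, Real.fourierInv_eq, low_apply, ← integral_indicator measurableSet_ball]
  refine integral_congr_ae ?_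
  filter_upwards [coeFn_cut R f] with ξ h
  rw [h]
  by_cases hξ : ξ ∈ Metric.ball (0 : Rn n) R
  · simp [hξ, Circle.smul_def, char, real_inner_comm]
  · simp [hξ]

theorem norm_cut_le (R : ℝ) (f : L2C n) : ‖cut R f‖ ≤ ‖f‖ := by
  refine Lp.norm_le_norm_of_ae_le ?_
  filter_upwards [coeFn_cut R f] with x h
  rw [h]
  exact norm_indicator_le_norm_self _ _

theorem norm_fourierInv (f : L2C n) : ‖(𝓕⁻ f : L2C n)‖ = ‖f‖ :=
  (Lp.fourierTransformₗᵢ (Rn n) ℂ).symm.norm_map f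

theorem fourierInv_sub (f g : L2C n) : 𝓕⁻ (f - g) = 𝓕⁻ f - 𝓕⁻ g :=
  (Lp.fourierTransformₗᵢ (Rn n) ℂ).symm.map_sub f g

/-- An `L²` function bounded by `M` is in `L^q` for `q ≥ 2`. -/
theorem lintegral_rpow_le_of_bound {q M : ℝ} (hq : 2 ≤ q) (g : L2C n)
    (hM : ∀ᵐ x, ‖g x‖ ≤ M) :
    ∫⁻ x, ‖g x‖ₑ ^ q ≤ ENNReal.ofReal (M ^ (q - 2) * ‖g‖ ^ 2) := by
  rw [norm_sq_eq_integral, ← integral_const_mul,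
    ofReal_integral_eq_lintegral_ofReal ((integrable_norm_sq g).const_mul _)]
  · refine lintegral_mono_ae (hM.mono fun x hx => ?_)
    rw [← ofReal_norm, ENNReal.ofReal_rpow_of_nonneg (norm_nonneg _) (by linarith)]
    refine ENNReal.ofReal_le_ofReal ?_
    calc ‖g x‖ ^ q = ‖g x‖ ^ (q - 2) * ‖g x‖ ^ 2 := by
          rw [← Real.rpow_two, ← Real.rpow_add_of_nonneg (norm_nonneg _) (by linarith) (by norm_num)]
          congr 1
          ring
      _ ≤ _ := by gcongr
  · refine hM.mono fun x hx => ?_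
    have : 0 ≤ M := (norm_nonneg _).trans hx
    simp only [Pi.zero_apply]
    positivity

theorem eLpNorm_ofReal {q : ℝ} (hq : 0 < q) {F : Type*} [NormedAddCommGroup F] (g : Rn n → F) :
    eLpNorm g (ENNReal.ofReal q) volume = (∫⁻ x, ‖g x‖ₑ ^ q) ^ (1 / q) := by
  rw [eLpNorm_eq_lintegral_rpow_enorm_toReal (by simpa using hq) ENNReal.ofReal_ne_top,
    ENNReal.toReal_ofReal hq.le]

/-- Bernstein's inequality. -/
theorem eLpNorm_fourierInv_cut_le {q : ℝ} (hq : 2 ≤ q) (R : ℝ) (f : L2C n) :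
    eLpNorm (𝓕⁻ (cut R f) : L2C n) (ENNReal.ofReal q) volume ≤
      ENNReal.ofReal (volume.real (Metric.ball (0 : Rn n) R) ^ (1 / 2 - 1 / q) * ‖f‖) := by
  set V := volume.real (Metric.ball (0 : Rn n) R) with hV
  have hq0 : 0 < q := by linarith
  have hV0 : 0 ≤ V := measureReal_nonneg
  have h1 : ∀ᵐ x, ‖(𝓕⁻ (cut R f) : L2C n) x‖ ≤ √V * ‖f‖ := by
    filter_upwards [coeFn_fourierInv_cut R f] with x hx
    rw [hx]
    exact norm_low_le R x f
  have h2 := lintegral_rpow_le_of_bound hq _ h1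
  have h3 : ‖(𝓕⁻ (cut R f) : L2C n)‖ ≤ ‖f‖ := by
    rw [norm_fourierInv]
    exact norm_cut_le R f
  rw [eLpNorm_ofReal hq0]
  -- Interpolation between the sup bound `√V ‖f‖` and the `L²` bound `‖f‖` leaves `V` with exponent
  -- `(q-2)/(2q) = 1/2 - 1/q`.
  calc _ ≤ (ENNReal.ofReal ((√V * ‖f‖) ^ (q - 2) * ‖f‖ ^ 2)) ^ (1 / q) := by
        refine ENNReal.rpow_le_rpow (h2.trans (ENNReal.ofReal_le_ofReal ?_)) (by positivity)
        gcongr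
    _ = _ := by
        rw [ENNReal.ofReal_rpow_of_nonneg (by positivity) (by positivity)]
        congr 1
        rw [← Real.rpow_natCast, Real.mul_rpow (by positivity) (norm_nonneg _), mul_assoc,
          Real.sqrt_eq_rpow,
          ← Real.rpow_add_of_nonneg (norm_nonneg _) (by linarith) (by norm_num),
          Real.mul_rpow (by positivity) (by positivity), ← Real.rpow_mul hV0,
          ← Real.rpow_mul hV0, ← Real.rpow_mul (norm_nonneg _)]
        have e1 : (1 : ℝ) / 2 * (q - 2) * (1 / q) = 1 / 2 - 1 / q := by field_simp
        have e2 : (q - 2 + ((2 : ℕ) : ℝ)) * (1 / q) = 1 := by push_cast; field_simp; ring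
        rw [e1, e2, Real.rpow_one]

/-- The high-frequency part of an `H¹` function is small in `L²`. -/
theorem norm_le_of_high {u : L2 n} (hu : MemH1 u) {R : ℝ} (hR : 0 < R) {f : L2C n}
    (hf : ∀ᵐ ξ, ‖f ξ‖ ≤ (Metric.ball 0 R)ᶜ.indicator (fun ξ => ‖hat u ξ‖) ξ) :
    ‖f‖ ≤ √(sobolevSq u) / R := by
  have h : R ^ 2 * ‖f‖ ^ 2 ≤ sobolevSq u := by
    rw [norm_sq_eq_integral, ← integral_const_mul, sobolevSq]
    refine integral_mono_ae ((integrable_norm_sq f).const_mul _) ((memH1_iff_integrable u).1 hu) ?_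
    filter_upwards [hf] with ξ h
    by_cases hξ : ξ ∈ Metric.ball (0 : Rn n) R
    · simp only [Set.mem_compl_iff, hξ, not_true_eq_false, not_false_eq_true,
        Set.indicator_of_notMem] at h
      have h0 : ‖f ξ‖ = 0 := le_antisymm h (norm_nonneg _)
      have : 0 ≤ (1 + ‖ξ‖ ^ 2) * ‖hat u ξ‖ ^ 2 := by positivity
      simpa [h0] using this
    · simp only [Set.mem_compl_iff, hξ, not_false_eq_true, Set.indicator_of_mem] at h
      have h1 : R ≤ ‖ξ‖ := by simpa using hξ
      have h2 : R ^ 2 ≤ 1 + ‖ξ‖ ^ 2 := by nlinarith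
      exact mul_le_mul h2 (by gcongr) (by positivity) (by positivity)
  rw [le_div_iff₀ hR]
  refine Real.le_sqrt_of_sq_le ?_
  linarith [mul_pow ‖f‖ R 2]

theorem norm_hat_sub_cut_le {u : L2 n} (hu : MemH1 u) {R : ℝ} (hR : 0 < R) :
    ‖hat u - cut R (hat u)‖ ≤ √(sobolevSq u) / R := by
  refine norm_le_of_high hu hR ?_
  filter_upwards [coeFn_cut R (hat u), Lp.coeFn_sub (hat u) (cut R (hat u))] with ξ h1 h2
  rw [h2, Pi.sub_apply, h1]
  by_cases hξ : ξ ∈ Metric.ball (0 : Rn n) R <;> simp [hξ]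

/-- A frequency annulus is a cutoff of the high-frequency part, so Bernstein's inequality on the
outer ball and the `H¹` decay outside the inner ball apply together. -/
theorem cut_sub_cut {R R' : ℝ} (h : R ≤ R') (f : L2C n) :
    cut R' f - cut R f = cut R' (f - cut R f) := by
  rw [map_sub]
  congr 1
  refine Lp.ext ?_
  filter_upwards [coeFn_cut R f, coeFn_cut R' (cut R f)] with ξ h1 h2
  rw [h2, h1]
  by_cases hξ : ξ ∈ Metric.ball (0 : Rn n) R
  · have : ξ ∈ Metric.ball (0 : Rn n) R' := Metric.ball_subset_ball h hξ
    simp [this, h1]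
  · by_cases hξ' : ξ ∈ Metric.ball (0 : Rn n) R' <;> simp [hξ, hξ', h1]

/-- An `L^q` bound passes to `L²` limits. -/
theorem eLpNorm_le_of_tendsto {q : ℝ≥0∞} {f : ℕ → L2C n} {g : L2C n}
    (h : Tendsto f atTop (𝓝 g)) {M : ℝ≥0∞} (hM : ∀ k, eLpNorm (f k) q volume ≤ M) :
    eLpNorm g q volume ≤ M := by
  obtain ⟨φ, -, hφ⟩ := (tendstoInMeasure_of_tendsto_Lp h).exists_seq_tendsto_ae
  refine (Lp.eLpNorm_lim_le_liminf_eLpNorm (fun k => Lp.aestronglyMeasurable (f (φ k))) _ hφ).trans ?_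
  exact liminf_le_of_le (by isBoundedDefault) fun b hb => by
    obtain ⟨k, hk⟩ := hb.exists
    exact hk.trans (hM _)

theorem volume_real_ball_two_pow (N : ℕ) :
    volume.real (Metric.ball (0 : Rn n) (2 ^ N)) =
      (2 ^ N) ^ n * volume.real (Metric.ball (0 : Rn n) 1) := by
  rw [measureReal_def, Measure.addHaar_ball_of_pos _ _ (by positivity), ENNReal.toReal_mul,
    ENNReal.toReal_ofReal (by positivity), measureReal_def, finrank_euclideanSpace_fin]

/-- The subcritical Sobolev inequality, for the high-frequency part. -/
theorem exists_sobolev_high (n : ℕ) {q : ℝ} (hq : 2 ≤ q) (hqn : (n : ℝ) * (1 / 2 - 1 / q) < 1) :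
    ∃ C r : ℝ, 0 ≤ C ∧ 0 < r ∧ r < 1 ∧ ∀ (u : L2 n), MemH1 u → ∀ N : ℕ,
      eLpNorm (toComplex u - 𝓕⁻ (cut (2 ^ N) (hat u)) : L2C n) (ENNReal.ofReal q) volume ≤
        ENNReal.ofReal (C * r ^ N * √(sobolevSq u)) := by
  set θ : ℝ := 1 / 2 - 1 / q with hθ
  have hθ0 : 0 ≤ θ := by
    have : 1 / q ≤ 1 / 2 := one_div_le_one_div_of_le (by norm_num) hq
    linarith
  set V := volume.real (Metric.ball (0 : Rn n) 1) with hV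
  -- On the annulus of radius about `2 ^ N`, Bernstein costs `2 ^ (nθN)` and `H¹` gains `2 ^ (-N)`.
  -- The ratio is below one exactly in the subcritical range.
  set r : ℝ := 2 ^ ((n : ℝ) * θ - 1) with hr
  have hr0 : 0 < r := by positivity
  have hr1 : r < 1 := Real.rpow_lt_one_of_one_lt_of_neg (by norm_num) (by linarith)
  set C₀ : ℝ := V ^ θ * 2 ^ ((n : ℝ) * θ) with hC₀
  have hC₀0 : 0 ≤ C₀ := by positivity
  have hpow : ∀ N : ℕ, (((2 : ℝ) ^ (N + 1)) ^ n) ^ θ =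
      2 ^ ((n : ℝ) * θ) * 2 ^ ((n : ℝ) * θ * N) := by
    intro N
    rw [← pow_mul, ← Real.rpow_natCast, ← Real.rpow_mul (by norm_num),
      ← Real.rpow_add (by norm_num)]
    congr 1
    push_cast
    ring
  have hrN : ∀ N : ℕ, r ^ N = 2 ^ ((n : ℝ) * θ * N) / 2 ^ N := by
    intro N
    rw [hr, Real.rpow_sub (by norm_num), Real.rpow_one, div_pow, ← Real.rpow_natCast _ N,
      ← Real.rpow_mul (by norm_num)]
  have step : ∀ (u : L2 n), MemH1 u → ∀ N : ℕ,
      eLpNorm (𝓕⁻ (cut (2 ^ (N + 1)) (hat u)) - 𝓕⁻ (cut (2 ^ N) (hat u)) : L2C n)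
        (ENNReal.ofReal q) volume ≤ ENNReal.ofReal (C₀ * √(sobolevSq u) * r ^ N) := by
    intro u hu N
    rw [← fourierInv_sub, cut_sub_cut (by gcongr <;> norm_num)]
    refine (eLpNorm_fourierInv_cut_le hq _ _).trans (ENNReal.ofReal_le_ofReal ?_)
    have h1 := norm_hat_sub_cut_le hu (R := 2 ^ N) (by positivity)
    rw [volume_real_ball_two_pow]
    calc _ ≤ (((2 : ℝ) ^ (N + 1)) ^ n * V) ^ θ * (√(sobolevSq u) / 2 ^ N) := by gcongr
      _ = _ := by
        rw [Real.mul_rpow (by positivity) measureReal_nonneg, hpow, hrN, hC₀]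
        ring
  have hr1' : 0 < 1 - r := by linarith
  refine ⟨C₀ / (1 - r), r, by positivity, hr0, hr1, fun u hu N => ?_⟩
  have hq1 : 1 ≤ ENNReal.ofReal q := by
    rw [← ENNReal.ofReal_one]
    exact ENNReal.ofReal_le_ofReal (by linarith)
  have sum : ∀ k : ℕ, eLpNorm (𝓕⁻ (cut (2 ^ (N + k)) (hat u)) - 𝓕⁻ (cut (2 ^ N) (hat u)) : L2C n)
      (ENNReal.ofReal q) volume ≤
      ENNReal.ofReal (C₀ * √(sobolevSq u) * (r ^ N * ∑ j ∈ Finset.range k, r ^ j)) := by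
    intro k
    induction k with
    | zero => 
      rw [add_zero, sub_self, eLpNorm_congr_ae (Lp.coeFn_zero ℂ 2 volume)]
      simp
    | succ k ih =>
      have e : (𝓕⁻ (cut (2 ^ (N + (k + 1))) (hat u)) - 𝓕⁻ (cut (2 ^ N) (hat u)) : L2C n) =
          (𝓕⁻ (cut (2 ^ (N + k + 1)) (hat u)) - 𝓕⁻ (cut (2 ^ (N + k)) (hat u))) +
          (𝓕⁻ (cut (2 ^ (N + k)) (hat u)) - 𝓕⁻ (cut (2 ^ N) (hat u))) := by
        rw [sub_add_sub_cancel]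
        rfl
      rw [e, eLpNorm_congr_ae (Lp.coeFn_add _ _)]
      refine (eLpNorm_add_le (Lp.aestronglyMeasurable _) (Lp.aestronglyMeasurable _) hq1).trans ?_
      refine (add_le_add (step u hu (N + k)) ih).trans ?_
      rw [← ENNReal.ofReal_add (by positivity) (by positivity), Finset.sum_range_succ]
      refine ENNReal.ofReal_le_ofReal (le_of_eq ?_)
      ring
  have hlim : Tendsto (fun k : ℕ => 𝓕⁻ (cut (2 ^ (N + k)) (hat u)) - 𝓕⁻ (cut (2 ^ N) (hat u)))
      atTop (𝓝 (toComplex u - 𝓕⁻ (cut (2 ^ N) (hat u)))) := by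
    refine Tendsto.sub_const ?_ _
    rw [← fourierInv_hat]
    refine (continuous_fourierInv.tendsto _).comp ?_
    rw [tendsto_iff_norm_sub_tendsto_zero]
    refine squeeze_zero (fun _ => norm_nonneg _) (fun k => ?_)
      (g := fun k => √(sobolevSq u) * ((1 / 2) ^ k)) ?_
    · rw [norm_sub_rev]
      refine (norm_hat_sub_cut_le hu (by positivity)).trans ?_
      rw [div_eq_mul_inv, one_div, inv_pow]
      gcongr
      · norm_num
      · omega
    · have := (tendsto_pow_atTop_nhds_zero_of_lt_one (r := (1 / 2 : ℝ)) (by norm_num)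
        (by norm_num)).const_mul (√(sobolevSq u))
      simpa using this
  -- The telescoped sums converge in `L²`; their uniform `L^q` bound passes to the limit by Fatou.
  refine eLpNorm_le_of_tendsto hlim fun k => (sum k).trans (ENNReal.ofReal_le_ofReal ?_)
  have hg : ∑ j ∈ Finset.range k, r ^ j ≤ (1 - r)⁻¹ := by
    rw [← tsum_geometric_of_lt_one hr0.le hr1]
    exact (summable_geometric_of_lt_one hr0.le hr1).sum_le_tsum _ fun _ _ => by positivity
  calc _ ≤ C₀ * √(sobolevSq u) * (r ^ N * (1 - r)⁻¹) := by gcongr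
    _ = _ := by ring

theorem lintegral_eq_K {p : ℝ} (hp : 1 < p) {u : L2 n}
    (hi : Integrable fun x => |u x| ^ (p + 1)) :
    ∫⁻ x, ‖toComplex u x‖ₑ ^ (p + 1) = ENNReal.ofReal ((p + 1) * K p u) := by
  have h : (p + 1) * K p u = ∫ x, |u x| ^ (p + 1) := by
    rw [K]
    field_simp
  rw [h, ofReal_integral_eq_lintegral_ofReal hi (Eventually.of_forall fun x => by positivity)]
  refine lintegral_congr_ae ?_
  filter_upwards [coeFn_toComplex u] with x hx
  rw [hx, ← ofReal_norm, Complex.norm_real, Real.norm_eq_abs,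
    ENNReal.ofReal_rpow_of_nonneg (abs_nonneg _) (by linarith)]

theorem one_le_ofReal {p : ℝ} (hp : 1 < p) : 1 ≤ ENNReal.ofReal (p + 1) := by
  rw [← ENNReal.ofReal_one]
  exact ENNReal.ofReal_le_ofReal (by linarith)

/-- The subcritical Sobolev embedding. -/
theorem MemH1.integrable_rpow {p : ℝ} (hp : 1 < p) (hpn : (n : ℝ) * (1 / 2 - 1 / (p + 1)) < 1)
    {u : L2 n} (hu : MemH1 u) : Integrable fun x => |u x| ^ (p + 1) := by
  obtain ⟨C, r, -, -, -, h⟩ := exists_sobolev_high n (by linarith : 2 ≤ p + 1) hpn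
  have h1 : eLpNorm (toComplex u) (ENNReal.ofReal (p + 1)) volume < ∞ := by
    have e : toComplex u = (toComplex u - 𝓕⁻ (cut (2 ^ 0) (hat u))) + 𝓕⁻ (cut (2 ^ 0) (hat u)) :=
      (sub_add_cancel _ _).symm
    rw [e, eLpNorm_congr_ae (Lp.coeFn_add _ _)]
    refine (eLpNorm_add_le (Lp.aestronglyMeasurable _) (Lp.aestronglyMeasurable _)
      (one_le_ofReal hp)).trans_lt ?_
    exact ENNReal.add_lt_top.2 ⟨(h u hu 0).trans_lt ENNReal.ofReal_lt_top,
      (eLpNorm_fourierInv_cut_le (by linarith) _ _).trans_lt ENNReal.ofReal_lt_top⟩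
  have h2 : MemLp (toComplex u) (ENNReal.ofReal (p + 1)) volume :=
    ⟨Lp.aestronglyMeasurable _, h1⟩
  have h3 := h2.integrable_norm_rpow (by simp; linarith) ENNReal.ofReal_ne_top
  rw [ENNReal.toReal_ofReal (by linarith)] at h3
  refine h3.congr ?_
  filter_upwards [coeFn_toComplex u] with x hx
  rw [hx, Complex.norm_real, Real.norm_eq_abs]

/-- A bounded family in `H¹` with `K = 1` has low-frequency parts that do not vanish. -/
theorem exists_le_norm_low {p : ℝ} (hp : 1 < p) (hpn : (n : ℝ) * (1 / 2 - 1 / (p + 1)) < 1)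
    {E : ℝ} (hE : 0 ≤ E) : ∃ R δ : ℝ, 0 < δ ∧ ∀ u : L2 n, MemH1 u → sobolevSq u ≤ E →
      K p u = 1 → ∃ x, δ ≤ ‖low R x (hat u)‖ := by
  obtain ⟨C, r, hC, hr0, hr1, h⟩ := exists_sobolev_high n (by linarith : 2 ≤ p + 1) hpn
  have hp0 : 0 < p + 1 := by linarith
  set κ : ℝ := (p + 1) ^ (1 / (p + 1)) with hκ
  have hκ0 : 0 < κ := by positivity
  -- The constraint `K = 1` means that the `L^{p+1}` norm is `κ`; this `N` leaves less than half of
  -- it to the high frequencies.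
  obtain ⟨N, hN⟩ : ∃ N : ℕ, C * √E * r ^ N < κ / 2 := by
    have := (tendsto_pow_atTop_nhds_zero_of_lt_one hr0.le hr1).const_mul (C * √E)
    rw [mul_zero] at this
    exact (this.eventually (gt_mem_nhds (by positivity))).exists
  set a : ℝ := (κ / 2) ^ (p + 1) with ha
  have ha0 : 0 < a := by positivity
  -- Chosen so that `δ ^ (p-1) * E ≤ a`: low frequencies below `δ` everywhere would carry at most `κ
  -- / 2`, and the two halves would fall short of `κ`. The `+ 1` keeps the denominator positive.
  set δ : ℝ := (a / (E + 1)) ^ (1 / (p - 1)) with hδ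
  have hδp : δ ^ (p + 1 - 2) = a / (E + 1) := by
    rw [hδ, ← Real.rpow_mul (by positivity)]
    have : 1 / (p - 1) * (p + 1 - 2) = 1 := by
      have : p - 1 ≠ 0 := by linarith
      field_simp
      ring
    rw [this, Real.rpow_one]
  refine ⟨2 ^ N, δ, by positivity, fun u hu hEu hK => ?_⟩
  by_contra! hcon
  set P : L2C n := 𝓕⁻ (cut (2 ^ N) (hat u)) with hP
  have h1 : eLpNorm (toComplex u) (ENNReal.ofReal (p + 1)) volume = ENNReal.ofReal κ := by
    rw [eLpNorm_ofReal hp0, lintegral_eq_K hp (hu.integrable_rpow hp hpn), hK, mul_one,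
      ENNReal.ofReal_rpow_of_pos hp0]
  have h2 : eLpNorm (toComplex u - P : L2C n) (ENNReal.ofReal (p + 1)) volume <
      ENNReal.ofReal (κ / 2) := by
    refine (h u hu N).trans_lt ((ENNReal.ofReal_lt_ofReal_iff (by positivity)).2 ?_)
    refine lt_of_le_of_lt ?_ hN
    have : √(sobolevSq u) ≤ √E := Real.sqrt_le_sqrt hEu
    calc _ ≤ C * r ^ N * √E := by gcongr
      _ = _ := by ring
  have h3 : eLpNorm P (ENNReal.ofReal (p + 1)) volume ≤ ENNReal.ofReal (κ / 2) := by
    have hb : ∀ᵐ x, ‖P x‖ ≤ δ := by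
      filter_upwards [coeFn_fourierInv_cut (2 ^ N) (hat u)] with x hx
      rw [hx]
      exact (hcon x).le
    rw [eLpNorm_ofReal hp0]
    have hPn : ‖P‖ ^ 2 ≤ E := by
      have : ‖P‖ ≤ ‖u‖ := by
        rw [hP, norm_fourierInv, ← norm_hat]
        exact norm_cut_le _ _
      calc ‖P‖ ^ 2 ≤ ‖u‖ ^ 2 := by gcongr
        _ ≤ E := (norm_sq_le_sobolevSq hu).trans hEu
    calc _ ≤ (ENNReal.ofReal a) ^ (1 / (p + 1)) := by
          refine ENNReal.rpow_le_rpow ((lintegral_rpow_le_of_bound (by linarith) P hb).trans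
            (ENNReal.ofReal_le_ofReal ?_)) (by positivity)
          rw [hδp, div_mul_eq_mul_div, div_le_iff₀ (by positivity)]
          gcongr
          linarith
      _ = _ := by
          rw [ENNReal.ofReal_rpow_of_pos ha0, ha, ← Real.rpow_mul (by positivity),
            mul_one_div_cancel hp0.ne', Real.rpow_one]
  have h4 : eLpNorm (toComplex u) (ENNReal.ofReal (p + 1)) volume < ENNReal.ofReal κ := by
    have e : toComplex u = (toComplex u - P) + P := (sub_add_cancel _ _).symm
    rw [e, eLpNorm_congr_ae (Lp.coeFn_add _ _)]
    refine (eLpNorm_add_le (Lp.aestronglyMeasurable _) (Lp.aestronglyMeasurable _)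
      (one_le_ofReal hp)).trans_lt ?_
    refine (ENNReal.add_lt_add_of_lt_of_le (ne_top_of_le_ne_top ENNReal.ofReal_ne_top h3) h2 h3).trans_eq ?_
    rw [← ENNReal.ofReal_add (by positivity) (by positivity), add_halves]
  exact h4.ne h1

/-! ### Weak limits, local compactness and the Brezis–Lieb lemma -/

/-- Bounded sequences in `L²` have weakly convergent subsequences. -/
theorem exists_weak_limit {f : ℕ → L2C n} {M : ℝ} (hf : ∀ k, ‖f k‖ ≤ M) :
    ∃ (g : L2C n) (φ : ℕ → ℕ), StrictMono φ ∧
      ∀ y : L2C n, Tendsto (fun k => inner ℝ (f (φ k)) y) atTop (𝓝 (inner ℝ g y)) := by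
  have : Fact ((2 : ℝ≥0∞) ≠ ∞) := ⟨by norm_num⟩
  have hc := WeakDual.isSeqCompact_closedBall ℝ (L2C n) 0 M
  obtain ⟨ψ, -, φ, hφ, hlim⟩ := hc (x := fun k => StrongDual.toWeakDual
    (InnerProductSpace.toDual ℝ (L2C n) (f k))) (fun k => by simpa using hf k)
  refine ⟨(InnerProductSpace.toDual ℝ (L2C n)).symm (WeakDual.toStrongDual ψ), φ, hφ, fun y => ?_⟩
  have := ((WeakDual.eval_continuous (𝕜 := ℝ) y).tendsto ψ).comp hlim
  rw [InnerProductSpace.toDual_symm_apply]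
  exact this

theorem tendsto_of_weak {f : ℕ → L2C n} {g : L2C n}
    (h : ∀ y : L2C n, Tendsto (fun k => inner ℝ (f k) y) atTop (𝓝 (inner ℝ g y)))
    (ℓ : L2C n →L[ℝ] ℝ) : Tendsto (fun k => ℓ (f k)) atTop (𝓝 (ℓ g)) := by
  have hℓ : ∀ z, ℓ z = inner ℝ z ((InnerProductSpace.toDual ℝ (L2C n)).symm ℓ) := fun z => by
    rw [real_inner_comm, InnerProductSpace.toDual_symm_apply]
  simp only [hℓ]
  exact h _

theorem tendsto_complex_of_weak {f : ℕ → L2C n} {g : L2C n}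
    (h : ∀ y : L2C n, Tendsto (fun k => inner ℝ (f k) y) atTop (𝓝 (inner ℝ g y)))
    (ℓ : L2C n →L[ℂ] ℂ) : Tendsto (fun k => ℓ (f k)) atTop (𝓝 (ℓ g)) := by
  have h1 := tendsto_of_weak h (Complex.reCLM ∘L ℓ.restrictScalars ℝ)
  have h2 := tendsto_of_weak h (Complex.imCLM ∘L ℓ.restrictScalars ℝ)
  have h3 := ((Complex.continuous_ofReal.tendsto _).comp h1).add
    (((Complex.continuous_ofReal.tendsto _).comp h2).mul_const Complex.I)
  simpa [Function.comp_def, Complex.re_add_im] using h3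

/-- The local form of Rellich's theorem. -/
theorem exists_subseq_ae_tendsto {w : ℕ → L2 n} (hw : ∀ k, MemH1 (w k)) {E : ℝ}
    (hE : ∀ k, sobolevSq (w k) ≤ E)
    (hlow : ∀ R x, Tendsto (fun k => low R x (hat (w k))) atTop (𝓝 0)) :
    ∃ φ : ℕ → ℕ, StrictMono φ ∧ ∀ᵐ x, Tendsto (fun k => w (φ k) x) atTop (𝓝 0) := by
  have hE0 : 0 ≤ E := (sobolevSq_nonneg _).trans (hE 0)
  -- A Gaussian weight does the localizing. It is integrable, which dominates the uniformly bounded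
  -- low frequencies; it is at most one, which keeps the high frequencies of size `E / R²`; and it
  -- is positive, so nothing is lost almost everywhere.
  set ρ : Rn n → ℝ := fun x => Real.exp (-‖x‖ ^ 2) with hρ
  have hρ0 : ∀ x, 0 < ρ x := fun x => Real.exp_pos _
  have hρ1 : ∀ x, ρ x ≤ 1 := fun x => Real.exp_le_one_iff.2 (by simp)
  have hρc : Continuous ρ := by fun_prop
  have hρi : Integrable ρ := by
    have := GaussianFourier.integrable_cexp_neg_mul_sq_norm_add (V := Rn n) (b := 1) (by simp) 0 0
    have := this.norm
    simpa [Complex.norm_exp, hρ, ← Complex.ofReal_pow] using this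
  have hρw : ∀ f : L2C n, Integrable fun x => ρ x * ‖f x‖ ^ 2 := fun f => by
    refine (integrable_norm_sq f).mono (hρc.aestronglyMeasurable.mul
      (integrable_norm_sq f).aestronglyMeasurable) (Eventually.of_forall fun x => ?_)
    rw [norm_mul, Real.norm_of_nonneg (hρ0 x).le]
    exact mul_le_of_le_one_left (norm_nonneg _) (hρ1 x)
  have hbound : ∀ R : ℝ, 0 < R → ∀ k, ∫ x, ρ x * ‖toComplex (w k) x‖ ^ 2 ≤
      2 * (∫ x, ρ x * ‖low R x (hat (w k))‖ ^ 2) + 2 * (E / R ^ 2) := by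
    intro R hR k
    set P : L2C n := 𝓕⁻ (cut R (hat (w k))) with hP
    have h1 : ∫ x, ρ x * ‖low R x (hat (w k))‖ ^ 2 = ∫ x, ρ x * ‖P x‖ ^ 2 := by
      refine integral_congr_ae ?_
      filter_upwards [coeFn_fourierInv_cut R (hat (w k))] with x hx
      rw [hP, hx]
    have h2 : ‖toComplex (w k) - P‖ ^ 2 ≤ E / R ^ 2 := by
      rw [hP, ← fourierInv_hat, ← fourierInv_sub, norm_fourierInv]
      calc _ ≤ (√(sobolevSq (w k)) / R) ^ 2 := by
            gcongr
            exact norm_hat_sub_cut_le (hw k) hR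
        _ ≤ _ := by
            rw [div_pow, Real.sq_sqrt (sobolevSq_nonneg _)]
            gcongr
            exact hE k
    rw [h1]
    refine le_trans ?_ (add_le_add_right (mul_le_mul_of_nonneg_left h2 zero_le_two) _)
    rw [norm_sq_eq_integral, ← integral_const_mul, ← integral_const_mul,
      ← integral_add ((hρw P).const_mul 2) ((integrable_norm_sq _).const_mul 2)]
    refine integral_mono_ae (hρw _) (((hρw P).const_mul 2).add
      ((integrable_norm_sq _).const_mul 2)) ?_
    filter_upwards [Lp.coeFn_sub (toComplex (w k)) P] with x hx
    rw [hx, Pi.sub_apply]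
    have h3 : ‖toComplex (w k) x‖ ≤ ‖P x‖ + ‖toComplex (w k) x - P x‖ := by
      have := norm_add_le (P x) (toComplex (w k) x - P x)
      rwa [add_sub_cancel] at this
    have h4 : ‖toComplex (w k) x‖ ^ 2 ≤ 2 * ‖P x‖ ^ 2 + 2 * ‖toComplex (w k) x - P x‖ ^ 2 := by
      calc _ ≤ (‖P x‖ + ‖toComplex (w k) x - P x‖) ^ 2 := by gcongr
        _ ≤ _ := by nlinarith [sq_nonneg (‖P x‖ - ‖toComplex (w k) x - P x‖)]
    have h5 : ρ x * (2 * ‖toComplex (w k) x - P x‖ ^ 2) ≤ 2 * ‖toComplex (w k) x - P x‖ ^ 2 :=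
      mul_le_of_le_one_left (by positivity) (hρ1 x)
    have h6 := mul_le_mul_of_nonneg_left h4 (hρ0 x).le
    linarith
  have hdct : ∀ R : ℝ, Tendsto (fun k => ∫ x, ρ x * ‖low R x (hat (w k))‖ ^ 2) atTop (𝓝 0) := by
    intro R
    set V := volume.real (Metric.ball (0 : Rn n) R) with hV
    have := tendsto_integral_of_dominated_convergence (μ := (volume : Measure (Rn n)))
      (F := fun k x => ρ x * ‖low R x (hat (w k))‖ ^ 2) (f := fun _ => 0) (fun x => ρ x * (V * E))
      (fun k => ?_) (hρi.mul_const _) (fun k => Eventually.of_forall fun x => ?_)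
      (Eventually.of_forall fun x => ?_)
    · simpa using this
    · refine ((hρw (𝓕⁻ (cut R (hat (w k))))).aestronglyMeasurable).congr ?_
      filter_upwards [coeFn_fourierInv_cut R (hat (w k))] with x hx
      rw [hx]
    · rw [norm_mul, Real.norm_of_nonneg (hρ0 x).le, norm_pow, norm_norm]
      gcongr
      calc _ ≤ (√V * ‖hat (w k)‖) ^ 2 := by
            gcongr
            exact norm_low_le R x _
        _ = V * ‖w k‖ ^ 2 := by rw [mul_pow, Real.sq_sqrt measureReal_nonneg, norm_hat]
        _ ≤ V * E := by
            gcongr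
            exact (norm_sq_le_sobolevSq (hw k)).trans (hE k)
    · have := ((hlow R x).norm.pow 2).const_mul (ρ x)
      simpa using this
  have hlim : Tendsto (fun k => ∫ x, ρ x * ‖toComplex (w k) x‖ ^ 2) atTop (𝓝 0) := by
    rw [Metric.tendsto_atTop]
    intro ε hε
    obtain ⟨R, hR0, hR⟩ : ∃ R : ℝ, 0 < R ∧ 2 * (E / R ^ 2) < ε / 2 := by
      have : Tendsto (fun R : ℝ => 2 * (E / R ^ 2)) atTop (𝓝 0) := by
        have := ((tendsto_pow_atTop (α := ℝ) (n := 2) (by norm_num)).const_div_atTop E).const_mul 2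
        simpa using this
      exact ((eventually_gt_atTop 0).and (this.eventually (gt_mem_nhds (by positivity)))).exists
    obtain ⟨k₀, hk₀⟩ := (Metric.tendsto_atTop.1 (hdct R)) (ε / 4) (by positivity)
    refine ⟨k₀, fun k hk => ?_⟩
    have h1 := hk₀ k hk
    have h2 := hbound R hR0 k
    rw [Real.dist_0_eq_abs] at h1 ⊢
    have h3 : 0 ≤ ∫ x, ρ x * ‖toComplex (w k) x‖ ^ 2 :=
      integral_nonneg fun x => mul_nonneg (hρ0 x).le (by positivity)
    rw [abs_of_nonneg h3]
    linarith [le_abs_self (∫ x, ρ x * ‖low R x (hat (w k))‖ ^ 2)]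
  have hmeas : TendstoInMeasure volume (fun k x => ρ x * ‖toComplex (w k) x‖ ^ 2) atTop
      (fun _ => (0 : ℝ)) := by
    refine tendstoInMeasure_of_tendsto_eLpNorm (p := 1) one_ne_zero
      (fun k => (hρw _).aestronglyMeasurable) aestronglyMeasurable_const ?_
    have : ∀ k, eLpNorm ((fun x => ρ x * ‖toComplex (w k) x‖ ^ 2) - fun _ => (0 : ℝ)) 1 volume =
        ENNReal.ofReal (∫ x, ρ x * ‖toComplex (w k) x‖ ^ 2) := by
      intro k
      rw [ofReal_integral_eq_lintegral_ofReal (hρw _)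
        (Eventually.of_forall fun x => mul_nonneg (hρ0 x).le (by positivity)),
        eLpNorm_one_eq_lintegral_enorm]
      refine lintegral_congr fun x => ?_
      rw [Pi.sub_apply, sub_zero, Real.enorm_of_nonneg (mul_nonneg (hρ0 x).le (by positivity))]
    simp only [this]
    have := (ENNReal.continuous_ofReal.tendsto _).comp hlim
    simpa [Function.comp_def] using this
  obtain ⟨φ, hφ, hae⟩ := hmeas.exists_seq_tendsto_ae
  refine ⟨φ, hφ, ?_⟩
  have hc : ∀ᵐ x, ∀ k, toComplex (w (φ k)) x = w (φ k) x :=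
    ae_all_iff.2 fun k => coeFn_toComplex _
  filter_upwards [hae, hc] with x hx hc
  have h1 := (hx.const_mul (ρ x)⁻¹).sqrt
  have h2 : ∀ k, √((ρ x)⁻¹ * (ρ x * ‖toComplex (w (φ k)) x‖ ^ 2)) = ‖w (φ k) x‖ := by
    intro k
    rw [inv_mul_cancel_left₀ (hρ0 x).ne', Real.sqrt_sq (norm_nonneg _), hc k, Complex.norm_real]
  simp only [h2, mul_zero, Real.sqrt_zero] at h1
  exact tendsto_zero_iff_norm_tendsto_zero.2 h1

/-- With `(1 + δ) ^ q = 1 + ε`, the first term suffices when `|y| ≤ δ |x - y|`, and otherwise `|x|`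
is bounded by a multiple of `|y|`. -/
theorem abs_rpow_le {q ε : ℝ} (hq : 0 < q) (hε : 0 < ε) :
    ∃ C, 1 ≤ C ∧ ∀ x y : ℝ, |x| ^ q ≤ (1 + ε) * |x - y| ^ q + C * |y| ^ q := by
  set δ : ℝ := (1 + ε) ^ (1 / q) - 1 with hδ
  have hδ0 : 0 < δ := sub_pos.2 (Real.one_lt_rpow (by linarith) (by positivity))
  have hδq : (1 + δ) ^ q = 1 + ε := by
    rw [hδ, add_sub_cancel, ← Real.rpow_mul (by positivity), one_div_mul_cancel hq.ne',
      Real.rpow_one]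
  refine ⟨(1 / δ + 1) ^ q, Real.one_le_rpow (by simp [hδ0.le]) hq.le, fun x y => ?_⟩
  have h : |x| ≤ |x - y| + |y| := by
    have := abs_add_le (x - y) y
    rwa [sub_add_cancel] at this
  rcases le_total |y| (δ * |x - y|) with h1 | h1
  · calc |x| ^ q ≤ ((1 + δ) * |x - y|) ^ q := by
          gcongr
          linarith
      _ = (1 + ε) * |x - y| ^ q := by rw [Real.mul_rpow (by positivity) (abs_nonneg _), hδq]
      _ ≤ _ := le_add_of_nonneg_right (by positivity)
  · calc |x| ^ q ≤ ((1 / δ + 1) * |y|) ^ q := by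
          gcongr
          have : |x - y| ≤ 1 / δ * |y| := by
            rw [one_div, inv_mul_eq_div, le_div_iff₀ hδ0]
            linarith
          linarith
      _ = (1 / δ + 1) ^ q * |y| ^ q := Real.mul_rpow (by positivity) (abs_nonneg _)
      _ ≤ _ := le_add_of_nonneg_left (by positivity)

/-- One half of the Brezis–Lieb lemma. -/
theorem brezis_lieb {α : Type*} [MeasurableSpace α] {μ : Measure α} {q : ℝ} (hq : 0 < q)
    {f : ℕ → α → ℝ} {g : α → ℝ} (hf : ∀ k, Integrable (fun x => |f k x| ^ q) μ)
    (hg : Integrable (fun x => |g x| ^ q) μ)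
    (hfg : ∀ k, Integrable (fun x => |f k x - g x| ^ q) μ)
    (hae : ∀ᵐ x ∂μ, Tendsto (fun k => f k x) atTop (𝓝 (g x)))
    {A b : ℝ} {β : ℕ → ℝ} (hA : ∀ k, ∫ x, |f k x| ^ q ∂μ = A)
    (hβ : ∀ k, ∫ x, |f k x - g x| ^ q ∂μ ≤ β k) (hb : Tendsto β atTop (𝓝 b)) :
    A ≤ ∫ x, |g x| ^ q ∂μ + b := by
  have key : ∀ ε > 0, A ≤ ∫ x, |g x| ^ q ∂μ + (1 + ε) * b := by
    intro ε hε
    obtain ⟨C, hC1, hC⟩ := abs_rpow_le hq hε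
    -- Fatou's lemma is applied to this nonnegative defect, whose pointwise limit is `(C - 1) |g| ^
    -- q`. The constant `C` cancels, and then `ε` tends to zero.
    set F : ℕ → α → ℝ := fun k x => (1 + ε) * |f k x - g x| ^ q + C * |g x| ^ q - |f k x| ^ q
    have hF0 : ∀ k x, 0 ≤ F k x := fun k x => sub_nonneg.2 (hC _ _)
    have hFi : ∀ k, Integrable (F k) μ := fun k =>
      (((hfg k).const_mul _).add (hg.const_mul _)).sub (hf k)
    have hFint : ∀ k, ∫ x, F k x ∂μ = (1 + ε) * ∫ x, |f k x - g x| ^ q ∂μ +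
        C * ∫ x, |g x| ^ q ∂μ - A := by
      intro k
      rw [← hA k, ← integral_const_mul, ← integral_const_mul,
        ← integral_add ((hfg k).const_mul _) (hg.const_mul _)]
      exact integral_sub (((hfg k).const_mul _).add (hg.const_mul _)) (hf k)
    have hlim : ∀ᵐ x ∂μ, Tendsto (fun k => F k x) atTop (𝓝 ((C - 1) * |g x| ^ q)) := by
      filter_upwards [hae] with x hx
      have h1 : Tendsto (fun k => |f k x - g x| ^ q) atTop (𝓝 0) := by
        have h0 : Tendsto (fun k => |f k x - g x|) atTop (𝓝 |g x - g x|) :=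
          (hx.sub_const (g x)).abs
        have := h0.rpow_const (p := q) (Or.inr hq.le)
        simpa [Real.zero_rpow hq.ne'] using this
      have h2 : Tendsto (fun k => |f k x| ^ q) atTop (𝓝 (|g x| ^ q)) :=
        hx.abs.rpow_const (Or.inr hq.le)
      have := ((h1.const_mul (1 + ε)).add_const (C * |g x| ^ q)).sub h2
      convert this using 2
      ring
    have hfatou := lintegral_liminf_le' (μ := μ) (u := atTop)
      (f := fun k x => ENNReal.ofReal (F k x)) fun k =>
        (hFi k).aestronglyMeasurable.aemeasurable.ennreal_ofReal
    have hl : ∫⁻ x, liminf (fun k => ENNReal.ofReal (F k x)) atTop ∂μ =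
        ENNReal.ofReal ((C - 1) * ∫ x, |g x| ^ q ∂μ) := by
      rw [← integral_const_mul, ofReal_integral_eq_lintegral_ofReal (hg.const_mul _)
        (Eventually.of_forall fun x => mul_nonneg (by linarith) (by positivity))]
      refine lintegral_congr_ae ?_
      filter_upwards [hlim] with x hx
      exact ((ENNReal.continuous_ofReal.tendsto _).comp hx).liminf_eq
    have hr : liminf (fun k => ∫⁻ x, ENNReal.ofReal (F k x) ∂μ) atTop ≤
        ENNReal.ofReal ((1 + ε) * b + C * ∫ x, |g x| ^ q ∂μ - A) := by
      have ht : Tendsto (fun k => ENNReal.ofReal ((1 + ε) * β k + C * ∫ x, |g x| ^ q ∂μ - A)) atTop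
          (𝓝 (ENNReal.ofReal ((1 + ε) * b + C * ∫ x, |g x| ^ q ∂μ - A))) :=
        (ENNReal.continuous_ofReal.tendsto _).comp
          (((hb.const_mul (1 + ε)).add_const _).sub_const _)
      rw [← ht.liminf_eq]
      refine liminf_le_liminf (Eventually.of_forall fun k => ?_)
      rw [← ofReal_integral_eq_lintegral_ofReal (hFi k) (Eventually.of_forall (hF0 k)), hFint]
      refine ENNReal.ofReal_le_ofReal ?_
      have := mul_le_mul_of_nonneg_left (hβ k) (by linarith : 0 ≤ 1 + ε)
      linarith
    -- `ENNReal.ofReal` truncates negative numbers, so the comparison descends to the reals only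
    -- once this bound is known to be nonnegative.
    have hnn : 0 ≤ (1 + ε) * b + C * ∫ x, |g x| ^ q ∂μ - A := by
      refine ge_of_tendsto' (((hb.const_mul (1 + ε)).add_const _).sub_const _) fun k => ?_
      have h1 : 0 ≤ ∫ x, F k x ∂μ := integral_nonneg (hF0 k)
      rw [hFint] at h1
      have := mul_le_mul_of_nonneg_left (hβ k) (by linarith : 0 ≤ 1 + ε)
      linarith
    rw [hl] at hfatou
    have := (ENNReal.ofReal_le_ofReal_iff hnn).1 (hfatou.trans hr)
    linarith
  have ht : Tendsto (fun ε : ℝ => ∫ x, |g x| ^ q ∂μ + (1 + ε) * b) (𝓝[>] 0)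
      (𝓝 (∫ x, |g x| ^ q ∂μ + (1 + 0) * b)) := by
    refine Tendsto.mono_left ?_ nhdsWithin_le_nhds
    exact Continuous.tendsto (by fun_prop) 0
  have := ge_of_tendsto ht (eventually_nhdsWithin_of_forall fun ε hε => key ε hε)
  linarith

/-! ### Scaling and existence of minimizers -/

theorem K_smul {p : ℝ} (t : ℝ) (u : L2 n) : K p (t • u) = |t| ^ (p + 1) * K p u := by
  rw [K, K, mul_left_comm]
  congr 1
  rw [← integral_const_mul]
  refine integral_congr_ae ?_
  filter_upwards [Lp.coeFn_smul t u] with x hx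
  rw [hx, Pi.smul_apply, smul_eq_mul, abs_mul, Real.mul_rpow (abs_nonneg _) (abs_nonneg _)]

theorem K_nonneg {p : ℝ} (hp : 1 < p) (u : L2 n) : 0 ≤ K p u :=
  mul_nonneg (by positivity) (integral_nonneg fun x => by positivity)

theorem K_pos {p : ℝ} (hp : 1 < p) {u : L2 n} (hi : Integrable fun x => |u x| ^ (p + 1))
    (hu : u ≠ 0) : 0 < K p u := by
  refine (K_nonneg hp u).lt_of_ne fun h => hu (Lp.eq_zero_iff_ae_eq_zero.2 ?_)
  have h1 : ∫ x, |u x| ^ (p + 1) = 0 := by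
    rcases mul_eq_zero.1 h.symm with h | h
    · have : 0 < 1 / (p + 1) := by positivity
      linarith
    · exact h
  rw [integral_eq_zero_iff_of_nonneg (fun x => by positivity) hi] at h1
  filter_upwards [h1] with x hx
  simp only [Pi.zero_apply] at hx ⊢
  rw [Real.rpow_eq_zero (abs_nonneg _) (by linarith)] at hx
  exact abs_eq_zero.1 hx

theorem exists_memH1_ne_zero (n : ℕ) : ∃ u : L2 n, MemH1 u ∧ u ≠ 0 := by
  obtain ⟨f⟩ : Nonempty (ContDiffBump (0 : Rn n)) := inferInstance
  have h1 : HasCompactSupport (Complex.ofRealCLM ∘ f) := f.hasCompactSupport.comp_left rfl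
  have h2 : ContDiff ℝ ((⊤ : ℕ∞) : WithTop ℕ∞) (Complex.ofRealCLM ∘ f) :=
    Complex.ofRealCLM.contDiff.comp f.contDiff
  set φ : SchwartzMap (Rn n) ℂ := h1.toSchwartzMap h2 with hφ
  have hf : MemLp f 2 (volume : Measure (Rn n)) :=
    f.continuous.memLp_of_hasCompactSupport f.hasCompactSupport
  have e : toComplex (hf.toLp f) = φ.toLp 2 := by
    refine Lp.ext ?_
    filter_upwards [coeFn_toComplex (hf.toLp f), hf.coeFn_toLp, φ.coeFn_toLp 2 volume]
      with x h1 h2 h3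
    rw [h1, h2, h3]
    rfl
  refine ⟨hf.toLp f, ?_, fun h => ?_⟩
  · rw [MemH1, e, Lp.toTemperedDistribution_toLp_eq]
    exact φ.memSobolev
  · have h3 : (f : Rn n → ℝ) =ᵐ[volume] 0 := by
      have := hf.coeFn_toLp
      rw [h] at this
      exact this.symm.trans (Lp.coeFn_zero ℝ 2 volume)
    have h4 := (f.continuous.ae_eq_iff_eq volume (continuous_const (y := (0 : ℝ)))).1 h3
    have h5 : f 0 = 1 := f.one_of_mem_closedBall (by simp [f.rIn_pos.le])
    rw [h4] at h5
    simp at h5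

section

variable {p : ℝ} {c : Rn n}

theorem exists_smul_K_eq_one (hp : 1 < p) {u : L2 n} (hK : 0 < K p u) :
    K p ((K p u ^ (-(1 / (p + 1)))) • u) = 1 ∧
      J c ((K p u ^ (-(1 / (p + 1)))) • u) = K p u ^ (-(2 / (p + 1))) * J c u := by
  have hp1 : p + 1 ≠ 0 := by linarith
  constructor
  · rw [K_smul, abs_of_pos (by positivity), ← Real.rpow_mul hK.le]
    have : -(1 / (p + 1)) * (p + 1) = -1 := by field_simp
    rw [this, Real.rpow_neg_one, inv_mul_cancel₀ hK.ne']
  · rw [J_smul, ← Real.rpow_natCast, ← Real.rpow_mul hK.le]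
    congr 2
    push_cast
    ring

theorem bddBelow_J (hc : ‖c‖ < 1) : BddBelow (J c '' {u : L2 n | MemH1 u ∧ K p u = 1}) :=
  ⟨0, by rintro _ ⟨u, ⟨hu, -⟩, rfl⟩; exact J_nonneg hu hc⟩

theorem mInf_le (hc : ‖c‖ < 1) {u : L2 n} (hu : MemH1 u) (hK : K p u = 1) : mInf p c ≤ J c u :=
  csInf_le (bddBelow_J hc) ⟨u, ⟨hu, hK⟩, rfl⟩

/-- The scale-invariant form of the definition of `m`: `J` is homogeneous of degree 2 and `K` of
degree `p + 1`. Comparisons with functions off the constraint go through it. -/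
theorem mInf_mul_rpow_le (hp : 1 < p) (hc : ‖c‖ < 1) {u : L2 n} (hu : MemH1 u) :
    mInf p c * K p u ^ (2 / (p + 1)) ≤ J c u := by
  rcases (K_nonneg hp u).eq_or_lt with h | h
  · rw [← h, Real.zero_rpow (by positivity), mul_zero]
    exact J_nonneg hu hc
  · obtain ⟨h1, h2⟩ := exists_smul_K_eq_one (c := c) hp h
    have h3 := mInf_le hc (hu.smul _) h1
    rw [h2, Real.rpow_neg h.le, inv_mul_eq_div, le_div_iff₀ (by positivity)] at h3
    exact h3

theorem K_le_rpow (hp : 1 < p) (hc : ‖c‖ < 1) (hm : 0 < mInf p c) {u : L2 n} (hu : MemH1 u) :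
    K p u ≤ (J c u / mInf p c) ^ ((p + 1) / 2) := by
  have h := mInf_mul_rpow_le hp hc hu
  have hK := K_nonneg hp u
  have h1 : K p u ^ (2 / (p + 1)) ≤ J c u / mInf p c := by
    rw [le_div_iff₀ hm]
    linarith
  calc K p u = (K p u ^ (2 / (p + 1))) ^ ((p + 1) / 2) := by
        rw [← Real.rpow_mul hK]
        have : 2 / (p + 1) * ((p + 1) / 2) = 1 := by
          have : p + 1 ≠ 0 := by linarith
          field_simp
        rw [this, Real.rpow_one]
    _ ≤ _ := by gcongr

theorem nonempty_constraint (hp : 1 < p) (hpn : (n : ℝ) * (1 / 2 - 1 / (p + 1)) < 1) :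
    {u : L2 n | MemH1 u ∧ K p u = 1}.Nonempty := by
  obtain ⟨u, hu, h0⟩ := exists_memH1_ne_zero n
  exact ⟨_, hu.smul _, (exists_smul_K_eq_one (c := 0) hp
    (K_pos hp (hu.integrable_rpow hp hpn) h0)).1⟩

theorem low_translate (R : ℝ) (a : Rn n) (u : L2 n) :
    low R 0 (hat (translate a u)) = low R a (hat u) := by
  rw [low_apply, low_apply]
  refine integral_congr_ae ?_
  filter_upwards [ae_restrict_of_ae (hat_translate a u)] with ξ h
  rw [h]
  simp [char]

theorem memLp_inv_sqrt_weight (hc : ‖c‖ < 1) :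
    MemLp (fun ξ => ((√(weight c ξ))⁻¹ : ℂ)) ∞ (volume : Measure (Rn n)) := by
  have hm := measurable_weight c
  have h0 : 0 < 1 - ‖c‖ ^ 2 := by nlinarith [norm_nonneg c]
  refine memLp_top_of_bound
    (by fun_prop : Measurable fun ξ => ((√(weight c ξ))⁻¹ : ℂ)).aestronglyMeasurable
    (√(1 - ‖c‖ ^ 2))⁻¹ (Eventually.of_forall fun ξ => ?_)
  rw [norm_inv, Complex.norm_real, Real.norm_of_nonneg (Real.sqrt_nonneg _)]
  have h1 : 1 - ‖c‖ ^ 2 ≤ weight c ξ :=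
    (le_mul_of_one_le_right h0.le (by simp)).trans (le_weight c ξ)
  gcongr

/-- Division by `√(weight c)`. -/
def unweight (hc : ‖c‖ < 1) : L2C n →L[ℂ] L2C n := mulL (memLp_inv_sqrt_weight hc)

theorem sqrt_weight_ne_zero (hc : ‖c‖ < 1) (ξ : Rn n) : ((√(weight c ξ) : ℝ) : ℂ) ≠ 0 := by
  have := weight_pos hc ξ
  exact_mod_cast (Real.sqrt_pos.2 this).ne'

theorem isWeighted_iff (hc : ‖c‖ < 1) {u : L2 n} {f : L2C n} :
    IsWeighted c u f ↔ unweight hc f = hat u := by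
  constructor
  · intro h
    refine Lp.ext ?_
    filter_upwards [h, coeFn_mulL (memLp_inv_sqrt_weight hc) f] with ξ h1 h2
    refine Eq.trans h2 ?_
    rw [h1, inv_mul_cancel_left₀ (sqrt_weight_ne_zero hc ξ)]
  · intro h
    have := coeFn_mulL (memLp_inv_sqrt_weight hc) f
    filter_upwards [this] with ξ h2
    rw [← h]
    change _ = _ * mulL (memLp_inv_sqrt_weight hc) f ξ
    rw [h2, mul_inv_cancel_left₀ (sqrt_weight_ne_zero hc ξ)]

theorem IsWeighted.memH1 (hc : ‖c‖ < 1) {u : L2 n} {f : L2C n} (h : IsWeighted c u f) :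
    MemH1 u := by
  have h0 : 0 < 1 - ‖c‖ ^ 2 := by nlinarith [norm_nonneg c]
  rw [memH1_iff_integrable]
  refine ((integrable_norm_sq f).const_mul (1 - ‖c‖ ^ 2)⁻¹).mono
    (AEStronglyMeasurable.mul (by fun_prop) (integrable_norm_sq _).aestronglyMeasurable) ?_
  filter_upwards [h] with ξ h1
  rw [h1, Real.norm_of_nonneg (by positivity), Real.norm_of_nonneg (by positivity), norm_mul,
    mul_pow, Complex.norm_real, Real.norm_eq_abs, sq_abs, Real.sq_sqrt (weight_pos hc ξ).le,
    ← mul_assoc]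
  gcongr
  rw [inv_mul_eq_div, le_div_iff₀ h0]
  linarith [le_weight c ξ]

/-- Weak limits of weighted transforms of real-valued functions come from a real-valued
function. -/
theorem exists_isWeighted_of_weak (hc : ‖c‖ < 1) {v : ℕ → L2 n} {f : ℕ → L2C n} {g : L2C n}
    (hf : ∀ k, IsWeighted c (v k) (f k))
    (h : ∀ y : L2C n, Tendsto (fun k => inner ℝ (f k) y) atTop (𝓝 (inner ℝ g y))) :
    ∃ u : L2 n, IsWeighted c u g := by
  set W : L2C n →L[ℝ] L2C n := (((Lp.fourierTransformₗᵢ (Rn n) ℂ).symm.toContinuousLinearEquiv :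
    L2C n →L[ℂ] L2C n) ∘L unweight hc).restrictScalars ℝ with hW
  have hWf : ∀ z, W z = 𝓕⁻ (unweight hc z) := fun z => rfl
  -- `T z` vanishes exactly when the unweighted inverse transform of `z` is real-valued. Since `T`
  -- is continuous and linear, its kernel is weakly closed.
  set T : L2C n →L[ℝ] L2C n := conjL ∘L W - W with hT
  have hTf : ∀ k, T (f k) = 0 := fun k => by
    change conjL (W (f k)) - W (f k) = 0
    rw [hWf, (isWeighted_iff hc).1 (hf k), fourierInv_hat, conjL_toComplex, sub_self]
  have hTg : T g = 0 := by
    have h1 := tendsto_of_weak h (innerSL ℝ (T g) ∘L T)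
    simp only [ContinuousLinearMap.comp_apply, hTf, map_zero] at h1
    have h2 := tendsto_nhds_unique h1 tendsto_const_nhds
    exact inner_self_eq_zero.1 h2
  refine ⟨reL (W g), (isWeighted_iff hc).2 ?_⟩
  have hz : toComplex (reL (W g)) = W g := toComplex_reL (sub_eq_zero.1 hTg)
  rw [hat, hz, hWf, FourierTransform.fourier_fourierInv_eq]

/-- On `(0, 1)` one has `t ^ τ < t`. This excludes the splitting of a minimizing sequence into two
pieces. -/
theorem eq_one_of_rpow_add_rpow {t τ : ℝ} (hτ : 1 < τ) (h0 : 0 < t) (h1 : t ≤ 1)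
    (h : 1 ≤ t ^ τ + (1 - t) ^ τ) : t = 1 := by
  by_contra hne
  have ht : t < 1 := lt_of_le_of_ne h1 hne
  have h2 := Real.rpow_lt_rpow_of_exponent_gt h0 ht hτ
  have h3 := Real.rpow_lt_rpow_of_exponent_gt (sub_pos.2 ht) (by linarith) hτ
  rw [Real.rpow_one] at h2 h3
  linarith

/-- The infimum defining `m(c)` is attained. -/
theorem exists_minimizer (hp : 1 < p) (hpn : (n : ℝ) * (1 / 2 - 1 / (p + 1)) < 1)
    (hc : ‖c‖ < 1) : ∃ u : L2 n, MemH1 u ∧ K p u = 1 ∧ J c u = mInf p c := by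
  have h0 : 0 < 1 - ‖c‖ ^ 2 := by nlinarith [norm_nonneg c]
  set m := mInf p c with hm
  obtain ⟨a, ha, hatend, hamem⟩ := exists_seq_tendsto_sInf
    ((nonempty_constraint hp hpn).image (J c)) (bddBelow_J hc)
  change Tendsto a atTop (𝓝 m) at hatend
  choose U hU hUa using hamem
  have hJU : ∀ k, J c (U k) ≤ a 0 := fun k => by
    rw [hUa]
    exact ha (Nat.zero_le k)
  have ha0 : 0 ≤ a 0 := by
    rw [← hUa 0]
    exact J_nonneg (hU 0).1 hc
  have hEU : ∀ k, sobolevSq (U k) ≤ 2 * a 0 / (1 - ‖c‖ ^ 2) := fun k => by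
    rw [le_div_iff₀ h0]
    linarith [sobolevSq_le_J (hU k).1 c, hJU k]
  -- No vanishing: each `U k` has a point where its low frequencies are at least `δ`, and
  -- translation moves that point to the origin.
  obtain ⟨R, δ, hδ, hlow⟩ := exists_le_norm_low hp hpn (E := 2 * a 0 / (1 - ‖c‖ ^ 2))
    (by positivity)
  choose y hy using fun k => hlow (U k) (hU k).1 (hEU k) (hU k).2
  set V : ℕ → L2 n := fun k => translate (y k) (U k) with hV
  have hVH : ∀ k, MemH1 (V k) := fun k => (hU k).1.translate _
  have hVK : ∀ k, K p (V k) = 1 := fun k => by rw [hV, K_translate, (hU k).2]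
  have hVJ : ∀ k, J c (V k) = a k := fun k => by rw [hV, J_translate, hUa]
  have hVlow : ∀ k, δ ≤ ‖low R 0 (hat (V k))‖ := fun k => by
    rw [hV, low_translate]
    exact hy k
  choose f hf using fun k => exists_isWeighted (hVH k) hc
  have hfn : ∀ k, ‖f k‖ ^ 2 = 2 * a k := fun k => by rw [(hf k).norm_sq (hVH k) hc, hVJ]
  have hfb : ∀ k, ‖f k‖ ≤ √(2 * a 0) := fun k => by
    refine Real.le_sqrt_of_sq_le ?_
    rw [hfn, ← hUa k]
    linarith [hJU k]
  obtain ⟨g, φ, hφ, hweak⟩ := exists_weak_limit hfb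
  obtain ⟨v, hv⟩ := exists_isWeighted_of_weak hc (fun k => hf (φ k)) hweak
  have hvH : MemH1 v := hv.memH1 hc
  have hgn : ‖g‖ ^ 2 = 2 * J c v := hv.norm_sq hvH hc
  have hlowlim : ∀ R x, Tendsto (fun k => low R x (hat (V (φ k)))) atTop
      (𝓝 (low R x (hat v))) := by
    intro R x
    have := tendsto_complex_of_weak hweak (low R x ∘L unweight hc)
    simpa only [ContinuousLinearMap.comp_apply, (isWeighted_iff hc).1 (hf _),
      (isWeighted_iff hc).1 hv] using this
  have hv0 : v ≠ 0 := by
    rintro rfl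
    have h1 := ge_of_tendsto' (hlowlim R 0).norm fun k => hVlow (φ k)
    rw [show hat (0 : L2 n) = 0 from hatL.map_zero, map_zero, norm_zero] at h1
    linarith
  have hJw : ∀ k, 2 * J c (V (φ k) - v) = ‖f (φ k) - g‖ ^ 2 := fun k =>
    (((hf (φ k)).sub hv).norm_sq ((hVH _).sub hvH) hc).symm
  -- Weak convergence in the Hilbert space of `J` splits the form asymptotically into that of the
  -- limit and that of the remainder.
  have hJlim : Tendsto (fun k => J c (V (φ k) - v)) atTop (𝓝 (m - J c v)) := by
    have h1 : Tendsto (fun k => (2 * a (φ k) - 2 * inner ℝ (f (φ k)) g + ‖g‖ ^ 2) / 2) atTop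
        (𝓝 ((2 * m - 2 * inner ℝ g g + ‖g‖ ^ 2) / 2)) :=
      ((((hatend.comp hφ.tendsto_atTop).const_mul 2).sub ((hweak g).const_mul 2)).add_const
        _).div_const 2
    have e : (2 * m - 2 * inner ℝ g g + ‖g‖ ^ 2) / 2 = m - J c v := by
      rw [real_inner_self_eq_norm_sq, hgn]
      ring
    rw [e] at h1
    refine h1.congr fun k => ?_
    have := hJw k
    rw [norm_sub_sq_real, hfn] at this
    linarith
  have hJv0 : 0 < J c v := J_pos hvH hv0 hc
  have hJvm : J c v ≤ m := by
    have := ge_of_tendsto' hJlim fun k => J_nonneg ((hVH (φ k)).sub hvH) hc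
    linarith
  -- Positivity of `m` is a by-product of the nonzero weak limit.
  have hm0 : 0 < m := hJv0.trans_le hJvm
  obtain ⟨ψ, hψ, hae⟩ := exists_subseq_ae_tendsto (w := fun k => V (φ k) - v)
    (E := (√(2 * a 0) + ‖g‖) ^ 2 / (1 - ‖c‖ ^ 2)) (fun k => (hVH _).sub hvH)
    (fun k => by
      rw [le_div_iff₀ h0]
      have h1 := sobolevSq_le_J ((hVH (φ k)).sub hvH) c
      rw [hJw] at h1
      have h2 : ‖f (φ k) - g‖ ^ 2 ≤ (√(2 * a 0) + ‖g‖) ^ 2 := by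
        gcongr
        exact (norm_sub_le _ _).trans (by gcongr; exact hfb _)
      linarith)
    (fun R x => by
      have := (hlowlim R x).sub_const (low R x (hat v))
      simpa only [hat_sub, map_sub, sub_self] using this)
  have hsub : ∀ᵐ x, ∀ k, (V (φ (ψ k)) - v : L2 n) x = V (φ (ψ k)) x - v x :=
    ae_all_iff.2 fun k => Lp.coeFn_sub _ _
  have haev : ∀ᵐ x, Tendsto (fun k => V (φ (ψ k)) x) atTop (𝓝 (v x)) := by
    filter_upwards [hae, hsub] with x h1 h2
    simp only [h2] at h1
    simpa using h1.add_const (v x)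
  have hp1 : p + 1 ≠ 0 := by linarith
  have hKint : ∀ u : L2 n, ∫ x, |u x| ^ (p + 1) = (p + 1) * K p u := fun u => by
    rw [K]
    field_simp
  have hsubint : ∀ k, (fun x => |(V (φ (ψ k)) - v : L2 n) x| ^ (p + 1)) =ᵐ[volume]
      fun x => |V (φ (ψ k)) x - v x| ^ (p + 1) := fun k => by
    filter_upwards [hsub] with x h
    rw [h k]
  -- The remainder's `K` is bounded by its `J` through the definition of `m`, so only an upper bound
  -- for it is needed, with a known limit.
  have hBL := brezis_lieb (q := p + 1) (by linarith) (f := fun k => V (φ (ψ k))) (g := v)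
    (fun k => (hVH _).integrable_rpow hp hpn) (hvH.integrable_rpow hp hpn)
    (fun k => (((hVH _).sub hvH).integrable_rpow hp hpn).congr (hsubint k)) haev (A := p + 1)
    (fun k => by rw [hKint, hVK, mul_one])
    (β := fun k => (p + 1) * (J c (V (φ (ψ k)) - v) / m) ^ ((p + 1) / 2))
    (fun k => by
      rw [← integral_congr_ae (hsubint k), hKint]
      have := K_le_rpow hp hc hm0 ((hVH (φ (ψ k))).sub hvH)
      gcongr)
    ((((hJlim.comp hψ.tendsto_atTop).div_const m).rpow_const (Or.inr (by positivity))).const_mul _)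
  rw [hKint, ← mul_add] at hBL
  have hBL1 : 1 ≤ K p v + ((m - J c v) / m) ^ ((p + 1) / 2) := by
    have hp1' : 0 < p + 1 := by linarith
    exact le_of_mul_le_mul_left (by linarith) hp1'
  have hKv := K_le_rpow hp hc hm0 hvH
  have e : (m - J c v) / m = 1 - J c v / m := by rw [sub_div, div_self hm0.ne']
  rw [e] at hBL1
  -- With `t = J(v) / m`, the mass balance reads `1 ≤ t ^ τ + (1 - t) ^ τ`, hence `t = 1` and the
  -- remainder carries no mass.
  have ht := eq_one_of_rpow_add_rpow (t := J c v / m) (τ := (p + 1) / 2) (by linarith)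
    (by positivity) ((div_le_one hm0).2 hJvm) (by linarith)
  rw [ht, sub_self, Real.zero_rpow (by positivity), add_zero] at hBL1
  rw [ht, Real.one_rpow] at hKv
  exact ⟨v, hvH, le_antisymm hKv hBL1, (div_eq_one_iff_eq hm0.ne').1 ht⟩

end

/-! ### Ground states, critical points and the value of `d` -/

section

variable {p : ℝ} {c : Rn n}

theorem K_zero (hp : 1 < p) : K p (0 : L2 n) = 0 := by
  have := K_smul (p := p) 0 (0 : L2 n)
  rwa [zero_smul, abs_zero, Real.zero_rpow (by linarith), zero_mul] at this

theorem J_zero_right (c : Rn n) : J c (0 : L2 n) = 0 := by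
  have := J_smul (u := (0 : L2 n)) c 0
  rwa [zero_smul, zero_pow two_ne_zero, zero_mul] at this

theorem mInf_pos (hp : 1 < p) (hpn : (n : ℝ) * (1 / 2 - 1 / (p + 1)) < 1) (hc : ‖c‖ < 1) :
    0 < mInf p c := by
  obtain ⟨u, hu, hK, hJ⟩ := exists_minimizer hp hpn hc
  rw [← hJ]
  refine J_pos hu ?_ hc
  rintro rfl
  rw [K_zero hp] at hK
  exact zero_ne_one hK

/-- The value of `J` on the ground states. -/
def groundLevel (p : ℝ) (c : Rn n) : ℝ :=
  (2 / (p + 1)) ^ (2 / (p - 1)) * mInf p c ^ ((p + 1) / (p - 1))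

theorem groundLevel_pos (hp : 1 < p) (hm : 0 < mInf p c) : 0 < groundLevel p c := by
  unfold groundLevel
  positivity

theorem mem_groundStates_iff {u : L2 n} : u ∈ groundStates p c ↔
    MemH1 u ∧ (p + 1) * K p u = 2 * J c u ∧ J c u = groundLevel p c := by
  simp only [groundStates, Set.mem_ofPred_eq, groundLevel]
  refine and_congr_right fun _ => and_congr_right fun _ => ⟨fun h => by linarith, fun h => by
    rw [h]; ring⟩

theorem groundStates_nonempty (hp : 1 < p) (hpn : (n : ℝ) * (1 / 2 - 1 / (p + 1)) < 1)
    (hc : ‖c‖ < 1) : (groundStates p c).Nonempty := by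
  obtain ⟨u, hu, hK, hJ⟩ := exists_minimizer hp hpn hc
  have hm := mInf_pos hp hpn hc
  have hp1 : 0 < p - 1 := by linarith
  -- For `t • u` with `K(u) = 1` and `J(u) = m`, the condition `(p+1) K = 2 J` reads `t ^ (p-1) = 2
  -- m / (p+1)`.
  set b : ℝ := 2 / (p + 1) * mInf p c with hb
  have hb0 : 0 < b := by positivity
  set t : ℝ := b ^ (1 / (p - 1)) with ht
  have ht0 : 0 < t := by positivity
  have ht2 : t ^ 2 = b ^ (2 / (p - 1)) := by
    rw [ht, ← Real.rpow_natCast, ← Real.rpow_mul hb0.le]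
    congr 1
    push_cast
    ring
  have htp : t ^ (p + 1) = t ^ 2 * b := by
    have : p + 1 = (p - 1) + 2 := by ring
    rw [this, Real.rpow_add ht0, Real.rpow_two, mul_comm]
    congr 1
    rw [ht, ← Real.rpow_mul hb0.le, one_div_mul_cancel hp1.ne', Real.rpow_one]
  refine ⟨t • u, mem_groundStates_iff.2 ⟨hu.smul t, ?_, ?_⟩⟩
  · rw [K_smul, J_smul, hK, hJ, abs_of_pos ht0, htp, hb]
    field_simp
  · have : (p + 1) / (p - 1) = 2 / (p - 1) + 1 := by field_simp; ring
    rw [J_smul, hJ, ht2, hb, groundLevel, this, Real.rpow_add hm, Real.rpow_one,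
      Real.mul_rpow (by positivity) hm.le]
    ring

/-- For `v = -L_c^{1/2} u` the term `c·F` equals `-‖v‖²`; added to `½ ‖v‖²` it gives the term `-½
‖L_c^{1/2} u‖²` of `J`. -/
theorem action_of_mem_groundPairs {w : L2 n × L2 n} (hw : w ∈ groundPairs p c) :
    action p c w = J c w.1 - K p w.1 := by
  rw [action, inner_momentum, energy, hw.2, norm_neg, inner_neg_left, real_inner_self_eq_norm_sq, J]
  ring

theorem K_eq_of_mem_groundStates (hp : 1 < p) {u : L2 n} (hu : u ∈ groundStates p c) :
    K p u = 2 / (p + 1) * J c u := by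
  have := (mem_groundStates_iff.1 hu).2.1
  field_simp
  linarith

theorem action_eq (hp : 1 < p) {w : L2 n × L2 n} (hw : w ∈ groundPairs p c) :
    action p c w = (p - 1) / (p + 1) * groundLevel p c := by
  rw [action_of_mem_groundPairs hw, K_eq_of_mem_groundStates hp hw.1,
    (mem_groundStates_iff.1 hw.1).2.2]
  field_simp
  ring

theorem groundPairs_nonempty (hp : 1 < p) (hpn : (n : ℝ) * (1 / 2 - 1 / (p + 1)) < 1)
    (hc : ‖c‖ < 1) : (groundPairs p c).Nonempty := by
  obtain ⟨u, hu⟩ := groundStates_nonempty hp hpn hc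
  exact ⟨(u, -lhalf c u), hu, rfl⟩

/-- All ground pairs have the same action, so the choice made in `d` is immaterial, and the study of
`d` reduces to that of `m`. -/
theorem d_eq (hp : 1 < p) (hpn : (n : ℝ) * (1 / 2 - 1 / (p + 1)) < 1) (hc : ‖c‖ < 1) :
    d p c = (p - 1) / (p + 1) * groundLevel p c :=
  action_eq hp (Classical.epsilon_spec (groundPairs_nonempty hp hpn hc))

/-- Ground states attain equality in `m K^{2/(p+1)} ≤ J`. -/
theorem mInf_mul_rpow_eq (hp : 1 < p) (hm : 0 < mInf p c) {u : L2 n}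
    (hu : u ∈ groundStates p c) : mInf p c * K p u ^ (2 / (p + 1)) = J c u := by
  have hp1 : 0 < p - 1 := by linarith
  have hp2 : 0 < p + 1 := by linarith
  have h0 : K p u = (2 / (p + 1) * mInf p c) ^ ((p + 1) / (p - 1)) := by
    have : (p + 1) / (p - 1) = 1 + 2 / (p - 1) := by field_simp; ring
    rw [K_eq_of_mem_groundStates hp hu, (mem_groundStates_iff.1 hu).2.2, groundLevel,
      Real.mul_rpow (by positivity) hm.le, ← mul_assoc]
    congr 1
    rw [this, Real.rpow_add (by positivity), Real.rpow_one]
  have e : (p + 1) / (p - 1) * (2 / (p + 1)) = 2 / (p - 1) := by field_simp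
  have e' : (p + 1) / (p - 1) = 1 + 2 / (p - 1) := by field_simp; ring
  rw [h0, ← Real.rpow_mul (by positivity), e, (mem_groundStates_iff.1 hu).2.2, groundLevel,
    Real.mul_rpow (by positivity) hm.le, e', Real.rpow_add hm, Real.rpow_one]
  ring

/-- Differentiation under the integral. The value of the derivative plays no role later, only its
existence. -/
theorem differentiableAt_K (hp : 1 < p) (hpn : (n : ℝ) * (1 / 2 - 1 / (p + 1)) < 1)
    {u w : L2 n} (hu : MemH1 u) (hw : MemH1 w) :
    DifferentiableAt ℝ (fun t : ℝ => K p (u + t • w)) 0 := by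
  set q := p + 1 with hq
  have hq1 : 1 < q := by linarith
  have hui := hu.integrable_rpow hp hpn
  have hwi := hw.integrable_rpow hp hpn
  have e : (fun t : ℝ => K p (u + t • w)) = fun t => 1 / q * ∫ x, |u x + t * w x| ^ q := by
    funext t
    rw [K]
    congr 1
    refine integral_congr_ae ?_
    filter_upwards [Lp.coeFn_add u (t • w), Lp.coeFn_smul t w] with x h1 h2
    rw [h1, Pi.add_apply, h2, Pi.smul_apply, smul_eq_mul]
  have hum := Lp.aestronglyMeasurable u
  have hwm := Lp.aestronglyMeasurable w
  have hum' := hum.aemeasurable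
  have hwm' := hwm.aemeasurable
  obtain ⟨C, hC1, hC⟩ := abs_rpow_le (q := q) (by linarith) one_pos
  rw [e]
  refine DifferentiableAt.const_mul ?_ _
  refine (hasDerivAt_integral_of_dominated_loc_of_deriv_le (μ := (volume : Measure (Rn n)))
    (F := fun (t : ℝ) x => |u x + t * w x| ^ q)
    (F' := fun (t : ℝ) x => q * |u x + t * w x| ^ (q - 2) * (u x + t * w x) * w x)
    -- For `|t| ≤ 1` the derivative is at most `q (|u| + |w|) ^ q`, which `abs_rpow_le` with `ε = 1`
    -- splits into two integrable terms.
    (bound := fun x => q * (2 * |u x| ^ q + C * |w x| ^ q))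
    (s := Metric.ball 0 1) (Metric.ball_mem_nhds 0 one_pos) (Eventually.of_forall fun t => ?_)
    ?_ ?_ (Eventually.of_forall fun x t ht => ?_) ?_
    (Eventually.of_forall fun x t ht => ?_)).2.differentiableAt
  · exact AEMeasurable.aestronglyMeasurable (by fun_prop)
  · simpa using hui
  · exact AEMeasurable.aestronglyMeasurable (by fun_prop)
  · have ht1 : |t| ≤ 1 := by simpa using (Metric.mem_ball.1 ht).le
    have h1 : |u x + t * w x| ≤ |u x| + |w x| := by
      refine (abs_add_le _ _).trans ?_
      rw [abs_mul]
      gcongr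
      exact mul_le_of_le_one_left (abs_nonneg _) ht1
    have h2 := hC (|u x| + |w x|) |w x|
    rw [add_sub_cancel_right, abs_abs, abs_abs, abs_of_nonneg (by positivity)] at h2
    have h3 : |u x + t * w x| ^ (q - 2) * |u x + t * w x| = |u x + t * w x| ^ (q - 1) := by
      rcases (abs_nonneg (u x + t * w x)).eq_or_lt with h | h
      · rw [← h, mul_zero, Real.zero_rpow (by linarith)]
      · rw [← Real.rpow_add_one h.ne']
        congr 1
        ring
    rw [norm_mul, norm_mul, norm_mul, Real.norm_of_nonneg (by linarith : 0 ≤ q),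
      Real.norm_of_nonneg (by positivity), Real.norm_eq_abs, Real.norm_eq_abs, mul_assoc q, h3,
      mul_assoc]
    gcongr
    have h4 : |w x| ≤ |u x| + |w x| := le_add_of_nonneg_left (abs_nonneg _)
    calc |u x + t * w x| ^ (q - 1) * |w x| ≤ (|u x| + |w x|) ^ (q - 1) * (|u x| + |w x|) := by
          gcongr
      _ = (|u x| + |w x|) ^ q := by
          rw [← Real.rpow_add_one' (by positivity) (by linarith)]
          congr 1
          ring
      _ ≤ _ := by linarith
  · exact ((hui.const_mul 2).add (hwi.const_mul C)).const_mul q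
  · have h1 : HasDerivAt (fun t : ℝ => u x + t * w x) (w x) t := by
      simpa using ((hasDerivAt_id t).mul_const (w x)).const_add (u x)
    have h2 := hasDerivAt_abs_rpow (u x + t * w x) hq1
    exact h2.comp t h1

theorem hasDerivAt_J {u w : L2 n} (hu : MemH1 u) (hw : MemH1 w) (hc : ‖c‖ < 1) :
    ∃ B, HasDerivAt (fun t : ℝ => J c (u + t • w)) B 0 := by
  obtain ⟨B, hB⟩ := exists_J_add_smul hu hw hc
  refine ⟨B, ?_⟩
  have h1 : HasDerivAt (fun t : ℝ => J c u + t * B + t ^ 2 * J c w)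
      (1 * B + ((2 : ℕ) * (0 : ℝ) ^ (2 - 1)) * J c w) 0 :=
    (((hasDerivAt_id (0 : ℝ)).mul_const B).const_add (J c u)).add
      ((hasDerivAt_pow 2 (0 : ℝ)).mul_const (J c w))
  simp only [hB]
  simpa using h1

/-- Ground states are critical points. -/
theorem isCriticalPoint_of_mem_groundStates (hp : 1 < p)
    (hpn : (n : ℝ) * (1 / 2 - 1 / (p + 1)) < 1) (hc : ‖c‖ < 1) {u : L2 n}
    (hu : u ∈ groundStates p c) : IsCriticalPoint p c u := by
  have hm := mInf_pos hp hpn hc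
  obtain ⟨hH, -, hJ⟩ := mem_groundStates_iff.1 hu
  refine ⟨hH, fun w hw => ?_⟩
  have hJ0 : 0 < J c u := hJ ▸ groundLevel_pos hp hm
  have hKJ := K_eq_of_mem_groundStates hp hu
  have hK0 : 0 < K p u := by rw [hKJ]; positivity
  obtain ⟨B, hB⟩ := hasDerivAt_J hH hw hc
  have hK := (differentiableAt_K hp hpn hH hw).hasDerivAt
  set k' := deriv (fun t : ℝ => K p (u + t • w)) 0
  have h1 := hB.sub ((hK.rpow_const (p := 2 / (p + 1))
    (Or.inl (by rw [zero_smul, add_zero]; exact hK0.ne'))).const_mul (mInf p c))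
  -- `J - m K^{2/(p+1)}` is nonnegative on `H¹` and vanishes at a ground state.
  have hmin : IsLocalMin ((fun t : ℝ => J c (u + t • w)) -
      fun t : ℝ => mInf p c * K p (u + t • w) ^ (2 / (p + 1))) 0 := by
    refine Eventually.of_forall fun t => ?_
    simp only [Pi.sub_apply]
    rw [zero_smul, add_zero, mInf_mul_rpow_eq hp hm hu, sub_self, sub_nonneg]
    exact mInf_mul_rpow_le hp hc (hH.add (hw.smul t))
  have h2 := hmin.hasDerivAt_eq_zero h1
  -- The factor `m (2/(p+1)) K^{2/(p+1) - 1}` equals `2 J / ((p+1) K) = 1`, so the derivative of `m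
  -- K^{2/(p+1)}` is that of `K` itself.
  have h3 : mInf p c * (k' * (2 / (p + 1)) * K p (u + (0 : ℝ) • w) ^ (2 / (p + 1) - 1)) = k' := by
    rw [zero_smul, add_zero, Real.rpow_sub_one hK0.ne']
    have := mInf_mul_rpow_eq hp hm hu
    have e : mInf p c * (k' * (2 / (p + 1)) * (K p u ^ (2 / (p + 1)) / K p u)) =
        k' * (2 / (p + 1)) * (mInf p c * K p u ^ (2 / (p + 1))) / K p u := by ring
    rw [e, this, hKJ]
    field_simp
  rw [h3] at h2
  have h4 := hB.sub hK
  rw [h2] at h4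
  exact h4

theorem ne_zero_of_mem_groundStates (hp : 1 < p) (hm : 0 < mInf p c) {u : L2 n}
    (hu : u ∈ groundStates p c) : u ≠ 0 := by
  rintro rfl
  have := (mem_groundStates_iff.1 hu).2.2
  rw [J_zero_right] at this
  exact (groundLevel_pos hp hm).ne this

/-- Critical points satisfy the Nehari identity. -/
theorem IsCriticalPoint.nehari (hp : 1 < p) {u : L2 n} (hu : IsCriticalPoint p c u) :
    (p + 1) * K p u = 2 * J c u := by
  have h1 := hu.2 u hu.1
  have e : (fun t : ℝ => scalarAction p c (u + t • u)) =
      fun t => (1 + t) ^ 2 * J c u - |1 + t| ^ (p + 1) * K p u := by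
    funext t
    have : u + t • u = (1 + t) • u := by rw [add_smul, one_smul]
    rw [this, scalarAction, J_smul, K_smul]
  rw [e] at h1
  have h0 : HasDerivAt (fun t : ℝ => 1 + t) 1 0 := (hasDerivAt_id (0 : ℝ)).const_add 1
  have h2 := (hasDerivAt_abs_rpow (1 + (0 : ℝ)) (by linarith : 1 < p + 1)).comp (0 : ℝ) h0
  have h3 := ((h0.pow 2).mul_const (J c u)).sub (h2.mul_const (K p u))
  have h4 := h1.unique h3
  simp at h4
  linarith

/-- By the Nehari identity the action of a critical point is `(p-1)/(p+1)` times its `J`. Comparison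
with a ground state, itself a critical point, bounds `J` above by the ground level; the inequality
`m K^{2/(p+1)} ≤ J` bounds it below. -/
theorem leastActionStates_subset (hp : 1 < p) (hpn : (n : ℝ) * (1 / 2 - 1 / (p + 1)) < 1)
    (hc : ‖c‖ < 1) : leastActionStates p c ⊆ groundStates p c := by
  rintro φ ⟨hφ0, hφc, hφ⟩
  have hm := mInf_pos hp hpn hc
  have hp1 : 0 < p - 1 := by linarith
  have hp2 : 0 < p + 1 := by linarith
  obtain ⟨ψ, hψ⟩ := groundStates_nonempty hp hpn hc
  have h1 := hφ ψ (ne_zero_of_mem_groundStates hp hm hψ)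
    (isCriticalPoint_of_mem_groundStates hp hpn hc hψ)
  have hN := hφc.nehari hp
  have hK : K p φ = 2 / (p + 1) * J c φ := by
    field_simp
    linarith
  have hJ0 : 0 < J c φ := J_pos hφc.1 hφ0 hc
  refine mem_groundStates_iff.2 ⟨hφc.1, hN, le_antisymm ?_ ?_⟩
  · rw [scalarAction, scalarAction, hK, K_eq_of_mem_groundStates hp hψ,
      (mem_groundStates_iff.1 hψ).2.2] at h1
    have h2 : 0 < 1 - 2 / (p + 1) := by
      rw [sub_pos, div_lt_one hp2]
      linarith
    nlinarith
  · have h2 := mInf_mul_rpow_le hp hc hφc.1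
    rw [hK, Real.mul_rpow (by positivity) hJ0.le] at h2
    have h3 : mInf p c * (2 / (p + 1)) ^ (2 / (p + 1)) ≤ J c φ ^ ((p - 1) / (p + 1)) := by
      have e : (p - 1) / (p + 1) = 1 - 2 / (p + 1) := by field_simp; ring
      rw [e, Real.rpow_sub hJ0, Real.rpow_one, le_div_iff₀ (by positivity)]
      linarith
    have h4 := Real.rpow_le_rpow (by positivity) h3 (by positivity : 0 ≤ (p + 1) / (p - 1))
    rw [← Real.rpow_mul hJ0.le, Real.mul_rpow hm.le (by positivity),
      ← Real.rpow_mul (by positivity)] at h4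
    have e1 : (p - 1) / (p + 1) * ((p + 1) / (p - 1)) = 1 := by field_simp
    have e2 : 2 / (p + 1) * ((p + 1) / (p - 1)) = 2 / (p - 1) := by field_simp
    rw [e1, e2, Real.rpow_one, mul_comm] at h4
    exact h4

end

/-! ### Dependence of `m` and `d` on the velocity -/

theorem norm_lhalf_le (c : Rn n) (u : L2 n) : ‖lhalf c u‖ ≤ ‖c‖ * ‖u‖ := by
  refine abs_le_of_sq_le_sq' ?_ (by positivity) |>.2
  rw [norm_sq_lhalf, mul_pow, norm_sq_eq_integral_hat, ← integral_const_mul]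
  refine integral_mono (integrable_halfSymbol c u) ((integrable_norm_sq _).const_mul _) fun ξ => ?_
  have := norm_halfSymbol_le c ξ
  simp only
  gcongr

theorem gradSq_nonneg (u : L2 n) : 0 ≤ gradSq u := integral_nonneg fun ξ => by positivity

theorem norm_smul_lt_one {s : Rn n} (hs : ‖s‖ ≤ 1) {ζ : ℝ} (hζ : ζ ∈ Set.Ico (0 : ℝ) 1) :
    ‖ζ • s‖ < 1 := by
  rw [norm_smul, Real.norm_of_nonneg hζ.1]
  exact (mul_le_of_le_one_right hζ.1 hs).trans_lt hζ.2

theorem J_smul_left (s : Rn n) (ζ : ℝ) (u : L2 n) :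
    J (ζ • s) u = 1 / 2 * (gradSq u + ‖u‖ ^ 2 - ζ ^ 2 * ‖lhalf s u‖ ^ 2) := by
  rw [J, lhalf_smul_left, norm_smul, mul_pow, Real.norm_eq_abs, sq_abs]

section

variable {p : ℝ}

/-- For fixed `u` the quotient `J(ζs; u) / (1 - ζ²)` is nondecreasing in `ζ`, because `‖L_s^{1/2} u‖
≤ ‖u‖`; it is evaluated at the minimizer for `ζ'`. With the monotonicity of `m` this gives
continuity without any bound on minimizers. -/
theorem mInf_ratio (hp : 1 < p) (hpn : (n : ℝ) * (1 / 2 - 1 / (p + 1)) < 1) {s : Rn n}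
    (hs : ‖s‖ ≤ 1) {ζ ζ' : ℝ} (hζ : ζ ∈ Set.Ico (0 : ℝ) 1) (hζ' : ζ' ∈ Set.Ico (0 : ℝ) 1)
    (h : ζ ≤ ζ') : (1 - ζ' ^ 2) * mInf p (ζ • s) ≤ (1 - ζ ^ 2) * mInf p (ζ' • s) := by
  obtain ⟨u, hu, hK, hJ⟩ := exists_minimizer hp hpn (norm_smul_lt_one hs hζ')
  have h1 := mInf_le (norm_smul_lt_one hs hζ) hu hK
  rw [← hJ]
  have h2 : (1 - ζ' ^ 2) * mInf p (ζ • s) ≤ (1 - ζ' ^ 2) * J (ζ • s) u :=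
    mul_le_mul_of_nonneg_left h1 (by nlinarith [hζ'.1, hζ'.2])
  refine h2.trans ?_
  rw [J_smul_left, J_smul_left]
  have h3 : ‖lhalf s u‖ ^ 2 ≤ gradSq u + ‖u‖ ^ 2 := by
    have h4 : ‖lhalf s u‖ ≤ ‖u‖ :=
      (norm_lhalf_le s u).trans (mul_le_of_le_one_left (norm_nonneg _) hs)
    have : ‖lhalf s u‖ ^ 2 ≤ ‖u‖ ^ 2 := by gcongr
    linarith [gradSq_nonneg u]
  have h5 : 0 ≤ ζ' ^ 2 - ζ ^ 2 := by nlinarith [hζ.1]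
  nlinarith [mul_nonneg h5 (sub_nonneg.2 h3)]

/-- The minimizer at the smaller speed competes at the larger one, where its `J` is strictly smaller
since `L_s^{1/2}` is injective for `s ≠ 0`. -/
theorem mInf_strictAntiOn (hp : 1 < p) (hpn : (n : ℝ) * (1 / 2 - 1 / (p + 1)) < 1) {s : Rn n}
    (hs0 : s ≠ 0) (hs : ‖s‖ ≤ 1) : StrictAntiOn (fun ζ : ℝ => mInf p (ζ • s)) (Set.Ico 0 1) := by
  intro ζ hζ ζ' hζ' h
  change mInf p (ζ' • s) < mInf p (ζ • s)
  obtain ⟨u, hu, hK, hJ⟩ := exists_minimizer hp hpn (norm_smul_lt_one hs hζ)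
  refine (mInf_le (norm_smul_lt_one hs hζ') hu hK).trans_lt ?_
  rw [← hJ, J_smul_left, J_smul_left]
  have hu0 : u ≠ 0 := by
    rintro rfl
    rw [K_zero hp] at hK
    exact zero_ne_one hK
  have h1 : 0 < ‖lhalf s u‖ ^ 2 := by
    have := norm_pos_iff.2 (lhalf_ne_zero hs0 hu0)
    positivity
  have h2 : ζ ^ 2 < ζ' ^ 2 := by nlinarith [hζ.1]
  nlinarith [mul_lt_mul_of_pos_right h2 h1]

theorem mInf_continuousOn (hp : 1 < p) (hpn : (n : ℝ) * (1 / 2 - 1 / (p + 1)) < 1) {s : Rn n}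
    (hs0 : s ≠ 0) (hs : ‖s‖ ≤ 1) : ContinuousOn (fun ζ : ℝ => mInf p (ζ • s)) (Set.Ico 0 1) := by
  intro ζ₀ hζ₀
  have h0 : 0 < 1 - ζ₀ ^ 2 := by nlinarith [hζ₀.1, hζ₀.2]
  have hanti := (mInf_strictAntiOn hp hpn hs0 hs).antitoneOn
  -- On either side of `ζ₀`, `m(ζ)` lies between `m(ζ₀)` and `m(ζ₀) (1 - ζ²) / (1 - ζ₀²)`.
  have hbound : ∀ ζ ∈ Set.Ico (0 : ℝ) 1, |mInf p (ζ • s) - mInf p (ζ₀ • s)| ≤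
      |mInf p (ζ₀ • s) * (1 - ζ ^ 2) / (1 - ζ₀ ^ 2) - mInf p (ζ₀ • s)| := by
    intro ζ hζ
    rcases le_total ζ ζ₀ with h | h
    · have h1 := hanti hζ hζ₀ h
      have h2 := mInf_ratio hp hpn hs hζ hζ₀ h
      have h3 : mInf p (ζ • s) ≤ mInf p (ζ₀ • s) * (1 - ζ ^ 2) / (1 - ζ₀ ^ 2) := by
        rw [le_div_iff₀ h0]
        linarith
      exact abs_le_abs_of_nonneg (sub_nonneg.2 h1) (by linarith)
    · have h1 := hanti hζ₀ hζ h
      have h2 := mInf_ratio hp hpn hs hζ₀ hζ h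
      have h3 : mInf p (ζ₀ • s) * (1 - ζ ^ 2) / (1 - ζ₀ ^ 2) ≤ mInf p (ζ • s) := by
        rw [div_le_iff₀ h0]
        linarith
      exact abs_le_abs_of_nonpos (sub_nonpos.2 h1) (by linarith)
  have hlim : Tendsto (fun ζ : ℝ => |mInf p (ζ₀ • s) * (1 - ζ ^ 2) / (1 - ζ₀ ^ 2) -
      mInf p (ζ₀ • s)|) (𝓝[Set.Ico 0 1] ζ₀) (𝓝 0) := by
    refine Tendsto.mono_left ?_ nhdsWithin_le_nhds
    have : Continuous fun ζ : ℝ => |mInf p (ζ₀ • s) * (1 - ζ ^ 2) / (1 - ζ₀ ^ 2) -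
      mInf p (ζ₀ • s)| := by fun_prop
    have h1 := this.tendsto ζ₀
    rwa [mul_div_cancel_right₀ _ h0.ne', sub_self, abs_zero] at h1
  refine tendsto_iff_norm_sub_tendsto_zero.2 ?_
  exact squeeze_zero' (Eventually.of_forall fun _ => norm_nonneg _)
    (eventually_nhdsWithin_of_forall hbound) hlim

theorem d_continuousOn (hp : 1 < p) (hpn : (n : ℝ) * (1 / 2 - 1 / (p + 1)) < 1) {s : Rn n}
    (hs0 : s ≠ 0) (hs : ‖s‖ ≤ 1) : ContinuousOn (fun ζ : ℝ => d p (ζ • s)) (Set.Ico 0 1) := by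
  have hp1 : 0 < p - 1 := by linarith
  have h : ContinuousOn (fun ζ : ℝ => (p - 1) / (p + 1) * ((2 / (p + 1)) ^ (2 / (p - 1)) *
      mInf p (ζ • s) ^ ((p + 1) / (p - 1)))) (Set.Ico 0 1) :=
    (((mInf_continuousOn hp hpn hs0 hs).rpow_const
      fun _ _ => Or.inr (by positivity)).const_mul _).const_mul _
  exact h.congr fun ζ hζ => d_eq hp hpn (norm_smul_lt_one hs hζ)

theorem d_strictAntiOn (hp : 1 < p) (hpn : (n : ℝ) * (1 / 2 - 1 / (p + 1)) < 1) {s : Rn n}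
    (hs0 : s ≠ 0) (hs : ‖s‖ ≤ 1) : StrictAntiOn (fun ζ : ℝ => d p (ζ • s)) (Set.Ico 0 1) := by
  intro ζ hζ ζ' hζ' h
  have hp1 : 0 < p - 1 := by linarith
  have h1 := mInf_strictAntiOn hp hpn hs0 hs hζ hζ' h
  have h2 := mInf_pos hp hpn (norm_smul_lt_one hs hζ')
  simp only
  rw [d_eq hp hpn (norm_smul_lt_one hs hζ), d_eq hp hpn (norm_smul_lt_one hs hζ'), groundLevel,
    groundLevel]
  gcongr

theorem d_ae_differentiableAt (hp : 1 < p) (hpn : (n : ℝ) * (1 / 2 - 1 / (p + 1)) < 1) {s : Rn n}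
    (hs0 : s ≠ 0) (hs : ‖s‖ ≤ 1) : ∀ᵐ ζ ∂(volume.restrict (Set.Ico (0 : ℝ) 1)),
      DifferentiableAt ℝ (fun ζ : ℝ => d p (ζ • s)) ζ := by
  have h1 := (d_strictAntiOn hp hpn hs0 hs).antitoneOn.neg.ae_differentiableWithinAt
    measurableSet_Ico
  have h2 : ∀ᵐ ζ ∂(volume.restrict (Set.Ico (0 : ℝ) 1)), ζ ∈ Set.Ioo (0 : ℝ) 1 := by
    rw [← restrict_Ioo_eq_restrict_Ico]
    exact ae_restrict_mem measurableSet_Ioo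
  filter_upwards [h1, h2] with ζ h3 h4
  have h5 := (h3.differentiableAt (Ico_mem_nhds h4.1 h4.2)).neg
  simpa using h5

theorem d_eq_of_norm_eq (hp : 1 < p) (hpn : (n : ℝ) * (1 / 2 - 1 / (p + 1)) < 1) {c c' : Rn n}
    (hc : ‖c‖ < 1) (h : ‖c'‖ = ‖c‖) : d p c' = d p c := by
  rw [d_eq hp hpn hc, d_eq hp hpn (h ▸ hc), groundLevel, groundLevel, mInf_eq_of_norm_eq p h]

/-- The function `d` is differentiable at the origin. -/
theorem differentiableAt_d_zero (hp : 1 < p) (hpn : (n : ℝ) * (1 / 2 - 1 / (p + 1)) < 1) :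
    DifferentiableAt ℝ (d p : Rn n → ℝ) 0 := by
  have hp1 : 0 < p - 1 := by linarith
  set α : ℝ := (p + 1) / (p - 1) with hα
  have hα1 : 1 ≤ α := by
    rw [hα, le_div_iff₀ hp1]
    linarith
  have h0 : ‖(0 : Rn n)‖ < 1 := by simp
  have hm0 := mInf_pos hp hpn h0
  have hκ : 0 ≤ (p - 1) / (p + 1) * (2 / (p + 1)) ^ (2 / (p - 1)) := by positivity
  -- Since `(1 - |c|²) m(0) ≤ m(c) ≤ m(0)`, Bernoulli's inequality with exponent `α ≥ 1` makes the
  -- increment of `d` quadratic. The origin is separate because the norm is not differentiable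
  -- there.
  have hd : ∀ c : Rn n, ‖c‖ < 1 → ‖d p c - d p (0 : Rn n)‖ ≤ d p (0 : Rn n) * α * ‖‖c - 0‖ ^ 2‖ := by
    intro c hc
    have hm := mInf_pos hp hpn hc
    have h1 : mInf p c ≤ mInf p (0 : Rn n) := by
      obtain ⟨u, hu, hK, hJ⟩ := exists_minimizer hp hpn h0
      refine (mInf_le hc hu hK).trans ?_
      have h2 := J_smul_left c 1 u
      have h3 := J_smul_left c 0 u
      rw [one_smul] at h2
      rw [zero_smul] at h3
      rw [← hJ, h2, h3]
      nlinarith [sq_nonneg ‖lhalf c u‖]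
    have h2 : (1 - ‖c‖ ^ 2) * mInf p (0 : Rn n) ≤ mInf p c := by
      obtain ⟨u, hu, hK, hJ⟩ := exists_minimizer hp hpn hc
      have h3 := mInf_le h0 hu hK
      have h4 := J_smul_left c 1 u
      have h5 := J_smul_left c 0 u
      rw [one_smul] at h4
      rw [zero_smul] at h5
      have h6 : 0 ≤ 1 - ‖c‖ ^ 2 := by nlinarith [norm_nonneg c]
      refine (mul_le_mul_of_nonneg_left h3 h6).trans ?_
      rw [← hJ, h4, h5]
      have h7 : ‖lhalf c u‖ ^ 2 ≤ (‖c‖ * ‖u‖) ^ 2 := by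
        gcongr
        exact norm_lhalf_le c u
      nlinarith [mul_nonneg (sq_nonneg ‖c‖) (gradSq_nonneg u)]
    have h3 : (1 - α * ‖c‖ ^ 2) * mInf p (0 : Rn n) ^ α ≤ mInf p c ^ α := by
      have h4 := one_add_mul_self_le_rpow_one_add (s := -‖c‖ ^ 2)
        (by nlinarith [norm_nonneg c]) hα1
      have h6 : 0 ≤ 1 - ‖c‖ ^ 2 := by nlinarith [norm_nonneg c]
      calc _ ≤ (1 - ‖c‖ ^ 2) ^ α * mInf p (0 : Rn n) ^ α := by
            gcongr
            rw [← sub_eq_add_neg] at h4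
            linarith
        _ = ((1 - ‖c‖ ^ 2) * mInf p (0 : Rn n)) ^ α := (Real.mul_rpow h6 hm0.le).symm
        _ ≤ _ := by gcongr
    have h4 : mInf p c ^ α ≤ mInf p (0 : Rn n) ^ α := by gcongr
    rw [d_eq hp hpn hc, d_eq hp hpn h0, groundLevel, groundLevel, ← hα, ← mul_assoc, ← mul_assoc,
      ← mul_sub, norm_mul, Real.norm_of_nonneg hκ, Real.norm_of_nonpos (by linarith), sub_zero,
      norm_pow, norm_norm]
    calc _ ≤ (p - 1) / (p + 1) * (2 / (p + 1)) ^ (2 / (p - 1)) *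
          (mInf p (0 : Rn n) ^ α * (α * ‖c‖ ^ 2)) :=
        mul_le_mul_of_nonneg_left (by linarith) hκ
      _ = _ := by ring
  have hO : (fun c : Rn n => d p c - d p (0 : Rn n)) =O[𝓝 0] fun c => ‖c - 0‖ ^ 2 := by
    refine Asymptotics.IsBigO.of_bound (d p (0 : Rn n) * α) ?_
    filter_upwards [Metric.ball_mem_nhds (0 : Rn n) one_pos] with c hc
    exact hd c (by simpa using hc)
  have h : DifferentiableAt ℝ (fun c : Rn n => d p c - d p (0 : Rn n)) 0 :=
    (hO.hasFDerivAt (𝕜 := ℝ) one_lt_two).differentiableAt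
  simpa using h.add_const (d p (0 : Rn n))

/-- Differentiability along a ray implies differentiability, since `d` is radial. -/
theorem differentiableAt_d (hp : 1 < p) (hpn : (n : ℝ) * (1 / 2 - 1 / (p + 1)) < 1) {s : Rn n}
    (hs0 : s ≠ 0) (hs : ‖s‖ ≤ 1) {ζ : ℝ} (hζ : ζ ∈ Set.Ico (0 : ℝ) 1)
    (h : DifferentiableWithinAt ℝ (fun ζ : ℝ => d p (ζ • s)) (Set.Ico 0 1) ζ) :
    DifferentiableAt ℝ (d p) (ζ • s) := by
  rcases hζ.1.eq_or_lt with h0 | h0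
  · rw [← h0, zero_smul]
    exact differentiableAt_d_zero hp hpn
  have hsn : 0 < ‖s‖ := norm_pos_iff.2 hs0
  have h1 := h.differentiableAt (Ico_mem_nhds h0 hζ.2)
  have hne : ζ • s ≠ 0 := smul_ne_zero h0.ne' hs0
  have hval : ‖ζ • s‖ / ‖s‖ = ζ := by
    rw [norm_smul, Real.norm_of_nonneg hζ.1, mul_div_cancel_right₀ _ hsn.ne']
  have h2 : DifferentiableAt ℝ (fun c : Rn n => ‖c‖ / ‖s‖) (ζ • s) := by
    have : DifferentiableAt ℝ (fun c : Rn n => ‖c‖) (ζ • s) := differentiableAt_id.norm ℝ hne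
    simpa only [div_eq_mul_inv] using this.mul_const ‖s‖⁻¹
  -- By radial symmetry `d` near `ζ • s` is its profile along the ray composed with `c ↦ ‖c‖ / ‖s‖`.
  have h3 : DifferentiableAt ℝ ((fun ζ : ℝ => d p (ζ • s)) ∘ fun c : Rn n => ‖c‖ / ‖s‖) (ζ • s) :=
    DifferentiableAt.comp (ζ • s) (by rw [hval]; exact h1) h2
  refine h3.congr_of_eventuallyEq ?_
  filter_upwards [Metric.isOpen_ball.mem_nhds
    (show ζ • s ∈ Metric.ball (0 : Rn n) 1 by simpa using norm_smul_lt_one hs hζ)] with c hc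
  refine (d_eq_of_norm_eq hp hpn (by simpa using hc) ?_).symm
  rw [norm_smul, norm_div, norm_norm, norm_norm, div_mul_cancel₀ _ hsn.ne']

/-- A ground state gives a smooth function touching `d` from above; the gradient of `d`, if it
exists, is that of the touching function. -/
theorem hasGradientAt_d (hp : 1 < p) (hpn : (n : ℝ) * (1 / 2 - 1 / (p + 1)) < 1) {c : Rn n}
    (hc : ‖c‖ < 1) (hd : DifferentiableAt ℝ (d p) c) {w : L2 n × L2 n}
    (hw : w ∈ groundPairs p c) : HasGradientAt (d p) (momentum w) c := by
  have hp1 : 0 < p - 1 := by linarith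
  have hp2 : 0 < p + 1 := by linarith
  have hm := mInf_pos hp hpn hc
  set φ := w.1 with hφ
  have hφG : φ ∈ groundStates p c := hw.1
  obtain ⟨hH, -, hJ⟩ := mem_groundStates_iff.1 hφG
  have hJ0 : 0 < J c φ := hJ ▸ groundLevel_pos hp hm
  have hKJ := K_eq_of_mem_groundStates hp hφG
  have hK0 : 0 < K p φ := by rw [hKJ]; positivity
  set α : ℝ := (p + 1) / (p - 1) with hα
  set κ : ℝ := (p - 1) / (p + 1) * (2 / (p + 1)) ^ (2 / (p - 1)) with hκ
  set a : ℝ := K p φ ^ (2 / (p + 1)) with ha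
  have ha0 : 0 < a := by positivity
  have hdκ : ∀ c' : Rn n, ‖c'‖ < 1 → d p c' = κ * mInf p c' ^ α := fun c' hc' => by
    rw [d_eq hp hpn hc', groundLevel, ← mul_assoc]
  -- The fixed function `φ`, rescaled to the constraint, competes in `m(c')` for every `c'`; at `c'
  -- = c` equality holds.
  have hle : ∀ c' : Rn n, ‖c'‖ < 1 → d p c' ≤ κ * (J c' φ / a) ^ α := fun c' hc' => by
    rw [hdκ c' hc']
    have h1 := mInf_mul_rpow_le hp hc' hH
    have h2 := mInf_pos hp hpn hc'
    have : mInf p c' ≤ J c' φ / a := (le_div_iff₀ ha0).2 h1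
    gcongr
  have heq : d p c = κ * (J c φ / a) ^ α := by
    rw [hdκ c hc, ← mInf_mul_rpow_eq hp hm hφG, mul_div_cancel_right₀ _ ha0.ne']
  -- `J` depends on `c'` only through `-½ ‖L_{c'}^{1/2} φ‖²`, quadratic in `c'`; its derivative at
  -- `c` pairs `-L_c^{1/2} φ`, the second component of `w`, with `L_y^{1/2} φ`.
  have hJd : HasFDerivAt (fun c' => J c' φ) (innerSL ℝ (momentum w)) c := by
    have h1 := ((lhalfLeft φ).hasFDerivAt (x := c)).norm_sq
    have h2 := (h1.const_sub (gradSq φ + ‖φ‖ ^ 2)).const_mul (1 / 2)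
    refine h2.congr_fderiv ?_
    ext y
    have h3 : inner ℝ (momentum w) y = -inner ℝ (lhalf c φ) (lhalf y φ) := by
      rw [real_inner_comm, inner_momentum, hw.2, inner_neg_left]
    simp [h3]
  have hh := ((hJd.mul_const a⁻¹).rpow_const (p := α)
    (Or.inl (mul_ne_zero hJ0.ne' (inv_ne_zero ha0.ne')))).const_mul κ
  -- The chain-rule factor is exactly one because of the ground state normalization `J / K =
  -- (p+1)/2`.
  have hcoef : κ * (α * (J c φ * a⁻¹) ^ (α - 1)) * a⁻¹ = 1 := by
    have e1 : α - 1 = 2 / (p - 1) := by rw [hα]; field_simp; ring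
    have e2 : (J c φ * a⁻¹) ^ (2 / (p - 1)) * a⁻¹ = (J c φ / K p φ) ^ (2 / (p - 1)) := by
      have e3 : 2 / (p + 1) * (2 / (p - 1)) + 2 / (p + 1) = 2 / (p - 1) := by field_simp; ring
      rw [Real.mul_rpow hJ0.le (by positivity), Real.inv_rpow ha0.le, mul_assoc, ← mul_inv, ha,
        ← Real.rpow_mul hK0.le, ← Real.rpow_add hK0, e3, ← div_eq_mul_inv,
        ← Real.div_rpow hJ0.le hK0.le]
    have e4 : J c φ / K p φ = (2 / (p + 1))⁻¹ := by
      rw [hKJ]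
      field_simp
    have e5 : κ * (α * (J c φ * a⁻¹) ^ (α - 1)) * a⁻¹ =
        κ * α * ((J c φ * a⁻¹) ^ (2 / (p - 1)) * a⁻¹) := by
      rw [e1]
      ring
    rw [e5, e2, e4, Real.inv_rpow (by positivity), hκ, hα]
    have : 0 < (2 / (p + 1)) ^ (2 / (p - 1)) := by positivity
    field_simp
  have hh' : HasFDerivAt (fun c' => κ * (J c' φ * a⁻¹) ^ α) (innerSL ℝ (momentum w)) c := by
    refine hh.congr_fderiv ?_
    rw [smul_smul, smul_smul, hcoef, one_smul]
  have hmax : IsLocalMax (fun c' => d p c' - κ * (J c' φ * a⁻¹) ^ α) c := by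
    filter_upwards [Metric.isOpen_ball.mem_nhds
      (show c ∈ Metric.ball (0 : Rn n) 1 by simpa using hc)] with c' hc'
    have := hle c' (by simpa using hc')
    rw [heq]
    simp only [← div_eq_mul_inv] at this ⊢
    linarith
  have h0 := hmax.hasFDerivAt_eq_zero (hd.hasFDerivAt.sub hh')
  rw [hasGradientAt_iff_hasFDerivAt]
  have h1 := hd.hasFDerivAt
  rw [sub_eq_zero.1 h0] at h1
  exact h1

end

/-- The condition says `n (p-1) < 2 (p+1)`: automatic for `n = 2`, and equivalent to `p <
(n+2)/(n-2)` for `n > 2`. -/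
theorem subcritical_exponent {n : ℕ} (hn : 2 ≤ n) {p : ℝ} (hp : 1 < p)
    (hp' : 2 < n → p < ((n : ℝ) + 2) / ((n : ℝ) - 2)) :
    (n : ℝ) * (1 / 2 - 1 / (p + 1)) < 1 := by
  have hp2 : 0 < p + 1 := by linarith
  have e : (n : ℝ) * (1 / 2 - 1 / (p + 1)) = n * (p - 1) / (2 * (p + 1)) := by
    field_simp
    ring
  rw [e, div_lt_one (by positivity)]
  rcases hn.eq_or_lt with h | h
  · rw [← h]
    push_cast
    linarith
  · have h1 : (2 : ℝ) < n := by exact_mod_cast h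
    have h2 := hp' h
    rw [lt_div_iff₀ (by linarith)] at h2
    nlinarith

end

end Boussinesq

theorem lemma2p8 (n : ℕ) (hn : 2 ≤ n) (p : ℝ) (hp : 1 < p)
    (hp' : 2 < n → p < ((n : ℝ) + 2) / ((n : ℝ) - 2)) :
    -- `d` is well defined on the open unit ball
    (∀ c : Boussinesq.Rn n, ‖c‖ < 1 → (Boussinesq.groundPairs p c).Nonempty ∧
      ∀ w ∈ Boussinesq.groundPairs p c, Boussinesq.d p c = Boussinesq.action p c w) ∧
    ∀ s : Boussinesq.Rn n, s ≠ 0 → ‖s‖ ≤ 1 →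
      ContinuousOn (fun ζ : ℝ => Boussinesq.d p (ζ • s)) (Set.Ico 0 1) ∧
      StrictAntiOn (fun ζ : ℝ => Boussinesq.d p (ζ • s)) (Set.Ico 0 1) ∧
      (∀ᵐ ζ ∂(volume.restrict (Set.Ico (0 : ℝ) 1)),
        DifferentiableAt ℝ (fun ζ : ℝ => Boussinesq.d p (ζ • s)) ζ) ∧
      ∀ ζ ∈ Set.Ico (0 : ℝ) 1,
        DifferentiableWithinAt ℝ (fun ζ : ℝ => Boussinesq.d p (ζ • s)) (Set.Ico 0 1) ζ →
        (∀ φ ∈ Boussinesq.leastActionStates p (ζ • s),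
          HasDerivWithinAt (fun ζ : ℝ => Boussinesq.d p (ζ • s))
            (-ζ * ‖Boussinesq.lhalf s φ‖ ^ 2) (Set.Ico 0 1) ζ) ∧
        (∀ w ∈ Boussinesq.groundPairs p (ζ • s),
          HasGradientAt (Boussinesq.d p) (Boussinesq.momentum w) (ζ • s)) := by
  have hpn := Boussinesq.subcritical_exponent hn hp hp'
  refine ⟨fun c hc => ⟨Boussinesq.groundPairs_nonempty hp hpn hc, fun w hw => ?_⟩,
    fun s hs0 hs => ⟨Boussinesq.d_continuousOn hp hpn hs0 hs,
      Boussinesq.d_strictAntiOn hp hpn hs0 hs, Boussinesq.d_ae_differentiableAt hp hpn hs0 hs,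
      fun ζ hζ hdiff => ?_⟩⟩
  · rw [Boussinesq.d_eq hp hpn hc, Boussinesq.action_eq hp hw]
  · have hc := Boussinesq.norm_smul_lt_one hs hζ
    have hd := Boussinesq.differentiableAt_d hp hpn hs0 hs hζ hdiff
    refine ⟨fun φ hφ => ?_, fun w hw => Boussinesq.hasGradientAt_d hp hpn hc hd hw⟩
    have hφG := Boussinesq.leastActionStates_subset hp hpn hc hφ
    have h1 := Boussinesq.hasGradientAt_d hp hpn hc hd
      (w := (φ, -Boussinesq.lhalf (ζ • s) φ)) ⟨hφG, rfl⟩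
    have h2 : HasDerivAt (fun ζ : ℝ => ζ • s) s ζ := by
      simpa using (hasDerivAt_id ζ).smul_const s
    have h3 := (h1.hasFDerivAt.comp_hasDerivAt ζ h2).hasDerivWithinAt (s := Set.Ico 0 1)
    refine h3.congr_deriv ?_
    -- Pairing the gradient with `s` gives `⟨-L_{ζs}^{1/2} φ, L_s^{1/2} φ⟩`, and `L_{ζs}^{1/2} = ζ
    -- L_s^{1/2}`.
    rw [InnerProductSpace.toDual_apply_apply, real_inner_comm, Boussinesq.inner_momentum,
      Boussinesq.lhalf_smul_left, inner_neg_left, inner_smul_left, real_inner_self_eq_norm_sq]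
    simp
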